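/- Let $F_2=\langle a,b\rangle$ be the free group on $a,b$, and let $\mathrm{Hol}(F_2)=F_2\rtimes\mathrm{Aut}(F_2)$ be its holomorph, with $\mathrm{Aut}(F_2)$ acting tautologically on $F_2$, so that $\varphi w\varphi^{-1}=\varphi(w)$ for $w\in F_2$ and $\varphi\in\mathrm{Aut}(F_2)$ (automorphisms compose as functions). Let $p,x,y\in\mathrm{Aut}(F_2)$ be the automorphisms $$p:\ a\mapsto b,\ b\mapsto a;\qquad x:\ a\mapsto b^{-1},\ b\mapsto a;\qquad y:\ a\mapsto ab^{-1},\ b\mapsto a,$$ and let $\tau_a,\tau_b$ be the inner automorphisms $\tau_a(w)=awa^{-1}$, $\tau_b(w)=bwb^{-1}$. Then every nontrivial element of finite order in $\mathrm{Hol}(F_2)$ is conjugate in $\mathrm{Hol}(F_2)$ to exactly one of the ten elements $$p,\quad px,\quad pxa,\quad px\tau_a,\quad px\tau_a a,\quad x^2,\quad x^2b,\quad y^2\tau_b^{-1},\quad y^2\tau_b^{-1}a,\quad x,$$ whose orders are $2,2,2,2,2,2,2,3,3,4$ respectively. -/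

import Mathlib

namespace HolF2

/-- The free group on two generators. -/
abbrev F2 : Type := FreeGroup (Fin 2)

/-- The holomorph `F₂ ⋊ Aut(F₂)`, where `Aut(F₂)` acts on `F₂` in the tautological way; automorphisms
compose as functions, so `φ * w * φ⁻¹ = φ(w)` holds in the holomorph. -/
abbrev Hol : Type := F2 ⋊[MonoidHom.id (MulAut F2)] MulAut F2

/-- The first free generator `a` of `F₂`. -/
def genA : F2 := FreeGroup.of 0

/-- The second free generator `b` of `F₂`. -/
def genB : F2 := FreeGroup.of 1

/-- The endomorphism of `F₂` with `a ↦ u`, `b ↦ v`. -/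
def endo (u v : F2) : F2 →* F2 := FreeGroup.lift ![u, v]

/-- The automorphism `p`: `a ↦ b`, `b ↦ a`. -/
def autP : MulAut F2 :=
  MonoidHom.toMulEquiv (endo genB genA) (endo genB genA)
    (by ext i; fin_cases i <;> simp [endo, genA, genB])
    (by ext i; fin_cases i <;> simp [endo, genA, genB])

/-- The automorphism `x`: `a ↦ b⁻¹`, `b ↦ a`; its inverse is `a ↦ b`, `b ↦ a⁻¹`. -/
def autX : MulAut F2 :=
  MonoidHom.toMulEquiv (endo genB⁻¹ genA) (endo genB genA⁻¹)
    (by ext i; fin_cases i <;> simp [endo, genA, genB])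
    (by ext i; fin_cases i <;> simp [endo, genA, genB])

/-- The automorphism `y`: `a ↦ a b⁻¹`, `b ↦ a`; its inverse is `a ↦ b`, `b ↦ a⁻¹ b`. -/
def autY : MulAut F2 :=
  MonoidHom.toMulEquiv (endo (genA * genB⁻¹) genA) (endo genB (genA⁻¹ * genB))
    (by ext i; fin_cases i <;> simp [endo, genA, genB])
    (by ext i; fin_cases i <;> simp [endo, genA, genB])

/-- `a` as an element of the holomorph. -/
def a : Hol := SemidirectProduct.inl genA

/-- `b` as an element of the holomorph. -/
def b : Hol := SemidirectProduct.inl genB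

/-- `p` as an element of the holomorph. -/
def p : Hol := SemidirectProduct.inr autP

/-- `x` as an element of the holomorph. -/
def x : Hol := SemidirectProduct.inr autX

/-- `y` as an element of the holomorph. -/
def y : Hol := SemidirectProduct.inr autY

/-- The inner automorphism `τ_a : w ↦ a w a⁻¹`, as an element of the holomorph. -/
def τa : Hol := SemidirectProduct.inr (MulAut.conj genA)

/-- The inner automorphism `τ_b : w ↦ b w b⁻¹`, as an element of the holomorph. -/
def τb : Hol := SemidirectProduct.inr (MulAut.conj genB)

/-- The ten representatives. -/
def rep : Fin 10 → Hol :=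
  ![p, p * x, p * x * a, p * x * τa, p * x * τa * a,
    x ^ 2, x ^ 2 * b, y ^ 2 * τb⁻¹, y ^ 2 * τb⁻¹ * a, x]

/-- The orders of the ten representatives. -/
def repOrder : Fin 10 → ℕ := ![2, 2, 2, 2, 2, 2, 2, 3, 3, 4]

end HolF2

/-!
An element `w φ` of `Hol(F₂)` is the same as the pair of automorphisms `(τ_w φ, φ)`, so `Hol(F₂)` is
the group of pairs of automorphisms with a common outer class. Abelianization identifies `Out(F₂)`
with `GL₂(ℤ)`: by Nielsen reduction, up to inner automorphisms and signed permutations of the basis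
every automorphism is a positive word in two transvections, and a nonempty positive word acts on
`ℤ²` by a nonnegative matrix with too large entries to act trivially. Gauss reduction of `2 × 2`
matrices then leaves seven outer classes of finite order.

For a fixed automorphism `φ` of finite order, conjugating `τ_w φ` by inner automorphisms amounts to
replacing `w` by `u w φ(u)⁻¹`. If `φ` permutes the letters and their inverses, it preserves lengths
and cancellation, and `τ_w φ` can only have finite order when at least half of `w` cancels against
`φ(w)` at every step of `w φ(w) φ²(w) ⋯`; this forces `w = r m φ(r)⁻¹` with `m` of length at most
one. The class of order three is not of this form, but it becomes a rotation of the theta graph,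
whose fundamental group sits inside the free group on three edges, where the same argument works.

The resulting pairs are told apart by the trace, determinant and reduction modulo two of their
matrices, and by exponent sums.
-/

namespace HolF2

open FreeGroup hiding map_one map_mul map_inv

section CommonPrefix

variable {β : Type*} [DecidableEq β]

/-- The length of the longest common prefix of two lists. -/
def commonPrefixLength : List β → List β → ℕ
  | x :: L, y :: M => if x = y then commonPrefixLength L M + 1 else 0
  | [], _ => 0
  | _ :: _, [] => 0

theorem le_commonPrefixLength_iff {L M : List β} {k : ℕ} :
    k ≤ commonPrefixLength L M ↔ k ≤ L.length ∧ k ≤ M.length ∧ L.take k = M.take k := by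
  induction L generalizing M k with
  | nil => simp +contextual [commonPrefixLength]
  | cons x L ih =>
    cases M with
    | nil => simp +contextual [commonPrefixLength]
    | cons y M =>
      cases k with
      | zero => simp
      | succ k => by_cases h : x = y <;> simp [commonPrefixLength, h, ih]

end CommonPrefix

section GromovProduct

variable {α : Type*}

theorem isReduced_invRev_append_cons {x y : α × Bool} {L M : List (α × Bool)}
    (hL : IsReduced (x :: L)) (hM : IsReduced (y :: M)) (hxy : x ≠ y) :
    IsReduced (invRev (x :: L) ++ y :: M) := by
  classical
  have hL' : IsReduced (invRev (x :: L)) := by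
    rw [isReduced_iff_reduce_eq, reduce_invRev, hL.reduce_eq]
  rw [invRev_cons] at hL' ⊢
  refine hL'.append_overlap ?_ (by simp [invRev])
  simp only [invRev, List.map_cons, List.map_nil, List.reverse_singleton, List.singleton_append,
    isReduced_cons_cons]
  refine ⟨fun h₁ => ?_, hM⟩
  have h₂ : x.2 ≠ y.2 := fun h₂ => hxy (Prod.ext h₁ h₂)
  grind

variable [DecidableEq α]

theorem norm_mk_of_isReduced {L : List (α × Bool)} (hL : IsReduced L) :
    (mk L).norm = L.length := by
  rw [FreeGroup.norm, toWord_mk, hL.reduce_eq]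

theorem norm_inv_mk_mul_mk {L M : List (α × Bool)} (hL : IsReduced L) (hM : IsReduced M) :
    ((mk L)⁻¹ * mk M).norm + 2 * commonPrefixLength L M = L.length + M.length := by
  induction L generalizing M with
  | nil => simpa [← one_eq_mk, commonPrefixLength] using norm_mk_of_isReduced hM
  | cons x L ih =>
    cases M with
    | nil =>
      rw [← one_eq_mk, mul_one, norm_inv_eq, norm_mk_of_isReduced hL]
      simp [commonPrefixLength]
    | cons y M =>
      by_cases h : x = y
      · subst h
        have hcons (N : List (α × Bool)) : mk (x :: N) = mk [x] * mk N := by simp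
        have hcancel : (mk (x :: L))⁻¹ * mk (x :: M) = (mk L)⁻¹ * mk M := by
          rw [hcons L, hcons M]
          group
        have := ih (M := M) (List.IsChain.tail hL) (List.IsChain.tail hM)
        simp only [hcancel, commonPrefixLength, if_true, List.length_cons]
        omega
      · rw [inv_mk, mul_mk, norm_mk_of_isReduced (isReduced_invRev_append_cons hL hM h)]
        simp [commonPrefixLength, h]

/-- The Gromov product of two elements based at `1` in the Cayley tree: the length of the longest
common prefix of their reduced words. -/
def gromovProduct (g h : FreeGroup α) : ℕ := commonPrefixLength g.toWord h.toWord

variable {g h k r s : FreeGroup α} {n : ℕ}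

theorem norm_inv_mul_add (g h : FreeGroup α) :
    (g⁻¹ * h).norm + 2 * gromovProduct g h = g.norm + h.norm := by
  simpa only [mk_toWord, FreeGroup.norm, gromovProduct] using
    norm_inv_mk_mul_mk (isReduced_toWord (x := g)) (isReduced_toWord (x := h))

theorem norm_mul_add (g h : FreeGroup α) :
    (g * h).norm + 2 * gromovProduct g⁻¹ h = g.norm + h.norm := by
  simpa using norm_inv_mul_add g⁻¹ h

theorem norm_inv_mul_comm (g h : FreeGroup α) : (g⁻¹ * h).norm = (h⁻¹ * g).norm := by
  rw [← norm_inv_eq, mul_inv_rev, inv_inv]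

theorem gromovProduct_comm (g h : FreeGroup α) : gromovProduct g h = gromovProduct h g := by
  have h₁ := norm_inv_mul_add g h
  have h₂ := norm_inv_mul_add h g
  rw [norm_inv_mul_comm] at h₁
  omega

theorem gromovProduct_le_left (g h : FreeGroup α) : gromovProduct g h ≤ g.norm :=
  (le_commonPrefixLength_iff.1 le_rfl).1

theorem le_gromovProduct_trans (h₁ : n ≤ gromovProduct g h) (h₂ : n ≤ gromovProduct h k) :
    n ≤ gromovProduct g k := by
  rw [gromovProduct, le_commonPrefixLength_iff] at *
  exact ⟨h₁.1, h₂.2.1, h₁.2.2.trans h₂.2.2⟩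

theorem gromovProduct_eq_of_lt (hlt : gromovProduct g h < gromovProduct h k) :
    gromovProduct g k = gromovProduct g h := by
  refine le_antisymm ?_ (le_gromovProduct_trans le_rfl hlt.le)
  by_contra! hc
  have := le_gromovProduct_trans (n := gromovProduct g h + 1) hc (gromovProduct_comm h k ▸ hlt)
  omega

theorem gromovProduct_mul_right (hlt : gromovProduct k g + gromovProduct g⁻¹ h < g.norm) :
    gromovProduct k (g * h) = gromovProduct k g := by
  apply gromovProduct_eq_of_lt
  have h₁ := norm_inv_mul_add g (g * h)
  have h₂ := norm_mul_add g h
  rw [inv_mul_cancel_left] at h₁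
  omega

theorem eq_of_norm_le_gromovProduct (hg : g.norm ≤ gromovProduct g h)
    (hh : h.norm ≤ gromovProduct g h) : g = h := by
  rw [← inv_mul_eq_one, ← FreeGroup.norm_eq_zero]
  have := norm_inv_mul_add g h
  omega

/-- The reduced word of `r` is a prefix of the reduced word of `g`; equivalently `r` lies on the
geodesic from `1` to `g` in the Cayley tree. -/
def IsPrefix (r g : FreeGroup α) : Prop := r.norm + (r⁻¹ * g).norm = g.norm

theorem IsPrefix.eq_one_or_eq (h : IsPrefix r g) (hg : g.norm ≤ 1) : r = 1 ∨ r = g := by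
  rw [← inv_mul_eq_one (a := r) (b := g), ← FreeGroup.norm_eq_zero (x := r),
    ← FreeGroup.norm_eq_zero (x := r⁻¹ * g)]
  rw [IsPrefix] at h
  omega

theorem isPrefix_iff : IsPrefix r g ↔ gromovProduct r g = r.norm := by
  have := norm_inv_mul_add r g
  rw [IsPrefix]
  omega

theorem exists_isPrefix (hn : n ≤ g.norm) : ∃ r : FreeGroup α, IsPrefix r g ∧ r.norm = n := by
  have hred := isReduced_toWord (x := g)
  have htake := norm_mk_of_isReduced (List.IsChain.take hred n)
  have hdrop := norm_mk_of_isReduced (List.IsChain.drop hred n)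
  have hg : g = mk (g.toWord.take n) * mk (g.toWord.drop n) := by simp [mk_toWord]
  have hlen : n ≤ g.toWord.length := hn
  rw [List.length_take, min_eq_left hlen] at htake
  refine ⟨mk (g.toWord.take n), ?_, htake⟩
  rw [IsPrefix, htake, inv_mul_eq_of_eq_mul hg, hdrop, List.length_drop, FreeGroup.norm]
  omega

namespace IsPrefix

theorem of_norm_le_gromovProduct (hr : IsPrefix r g) (hle : r.norm ≤ gromovProduct g h) :
    IsPrefix r h := by
  rw [isPrefix_iff] at *
  exact le_antisymm (gromovProduct_le_left r h) (le_gromovProduct_trans hr.ge hle)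

theorem of_norm_le (hr : IsPrefix r g) (hs : IsPrefix s g) (hle : r.norm ≤ s.norm) :
    IsPrefix r s := by
  apply hr.of_norm_le_gromovProduct
  rwa [gromovProduct_comm, isPrefix_iff.1 hs]

theorem eq_of_norm_eq (hr : IsPrefix r g) (hs : IsPrefix s h) (heq : r.norm = s.norm)
    (hle : r.norm ≤ gromovProduct g h) : r = s := by
  have hrs := (hr.of_norm_le_gromovProduct hle).of_norm_le hs heq.le
  rw [isPrefix_iff] at hrs
  exact eq_of_norm_le_gromovProduct hrs.ge (hrs.trans heq).ge

theorem inv_mul_inv (hr : IsPrefix r g) : IsPrefix (g⁻¹ * r) g⁻¹ := by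
  have h₁ := norm_inv_mul_comm r g
  rw [IsPrefix] at *
  rw [mul_inv_rev, inv_inv, mul_inv_cancel_right, norm_inv_eq, norm_inv_eq]
  omega

theorem norm_inv_mul_mul (hr : IsPrefix r g) (hs : IsPrefix s g⁻¹)
    (hle : r.norm + s.norm ≤ g.norm) : (r⁻¹ * g * s).norm + r.norm + s.norm = g.norm := by
  have hn := norm_inv_mul_comm r g
  have hrn := hr
  rw [IsPrefix] at hrn
  have hs' : s.norm + (s⁻¹ * (g⁻¹ * r)).norm = (g⁻¹ * r).norm :=
    hs.of_norm_le hr.inv_mul_inv (by omega)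
  rw [← norm_inv_eq, mul_inv_rev, mul_inv_rev, inv_inv]
  omega

theorem mul_cases (hr : IsPrefix r (g * h)) : IsPrefix r g ∨ ∃ s, IsPrefix s h ∧ r = g * s := by
  have h₁ := norm_inv_mul_add g (g * h)
  rw [inv_mul_cancel_left] at h₁
  have hr' := isPrefix_iff.1 hr
  rcases le_or_gt r.norm (gromovProduct g (g * h)) with hle | hlt
  · left
    exact hr.of_norm_le_gromovProduct (gromovProduct_comm g _ ▸ hle)
  · right
    refine ⟨g⁻¹ * r, ?_, by group⟩
    have h₂ : gromovProduct g r = gromovProduct g (g * h) :=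
      gromovProduct_eq_of_lt (by rwa [gromovProduct_comm _ r, hr'])
    have h₃ := norm_inv_mul_add g r
    have h₄ : (g⁻¹ * r)⁻¹ * h = r⁻¹ * (g * h) := by group
    rw [IsPrefix] at hr ⊢
    rw [h₄]
    omega

end IsPrefix

end GromovProduct

section Center

variable {α : Type*} [Nontrivial α]

theorem eq_one_of_forall_commute_of {z : FreeGroup α} (hz : ∀ i, Commute z (of i)) : z = 1 := by
  classical
  by_contra hne
  obtain ⟨x, L, hx⟩ := List.exists_cons_of_ne_nil (mt toWord_eq_nil_iff.1 hne)
  obtain ⟨i, hi⟩ := exists_ne x.1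
  have hred : IsReduced ((i, true) :: z.toWord) := by
    rw [hx, isReduced_cons_cons, ← hx]
    exact ⟨fun e => absurd e hi, isReduced_toWord⟩
  have hword : (of i * z).toWord = (i, true) :: z.toWord := by
    rw [← hred.reduce_eq, ← toWord_mk]
    conv_lhs => rw [← mk_toWord (x := z)]
    rfl
  have hsub := toWord_mul_sublist z (of i)
  rw [(hz i).eq, hword, toWord_of] at hsub
  have hcons := hsub.eq_of_length (by simp)
  rw [hx, List.cons_append, List.cons.injEq] at hcons
  exact hi (by rw [← hcons.1])

theorem conj_injective : Function.Injective (MulAut.conj (G := FreeGroup α)) := by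
  rw [injective_iff_map_eq_one]
  intro z hz
  refine eq_one_of_forall_commute_of fun i => ?_
  have := DFunLike.congr_fun hz (of i)
  rwa [MulAut.conj_apply, MulAut.one_apply, mul_inv_eq_iff_eq_mul] at this

end Center

section TwistedPowers

variable {G H : Type*} [Group G] [Group H]

theorem mul_conj (φ : MulAut G) (u : G) : φ * MulAut.conj u = MulAut.conj (φ u) * φ := by
  ext w
  simp

/-- The twisted power `w φ(w) ⋯ φⁿ⁻¹(w)`: it is the component in `G` of `(w φ)ⁿ ∈ G ⋊ Aut G`. -/
def twistedPow (φ : MulAut G) (w : G) : ℕ → G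
  | 0 => 1
  | n + 1 => w * φ (twistedPow φ w n)

theorem conj_mul_pow (φ : MulAut G) (w : G) (n : ℕ) :
    (MulAut.conj w * φ) ^ n = MulAut.conj (twistedPow φ w n) * φ ^ n := by
  induction n with
  | zero => simp [twistedPow]
  | succ n ih =>
    rw [pow_succ', ih, mul_assoc, ← mul_assoc φ, mul_conj, twistedPow, map_mul, pow_succ']
    simp only [mul_assoc]

theorem map_twistedPow {φ : MulAut G} {ψ : MulAut H} {f : G →* H}
    (hf : ∀ g, f (φ g) = ψ (f g)) (w : G) (n : ℕ) :
    f (twistedPow φ w n) = twistedPow ψ (f w) n := by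
  induction n with
  | zero => simp [twistedPow]
  | succ n ih => simp [twistedPow, hf, ih]

theorem exists_twistedPow_eq_one (hG : Function.Injective (MulAut.conj (G := G))) {φ : MulAut G}
    {w : G} (hφ : IsOfFinOrder φ) (h : IsOfFinOrder (MulAut.conj w * φ)) :
    ∃ n ≠ 0, twistedPow φ w n = 1 := by
  obtain ⟨n, hn, hwφ⟩ := isOfFinOrder_iff_pow_eq_one.1 h
  obtain ⟨k, hk, hφ⟩ := isOfFinOrder_iff_pow_eq_one.1 hφ
  refine ⟨k * n, by positivity, hG ?_⟩
  have hpow := conj_mul_pow φ w (k * n)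
  rw [pow_mul', hwφ, one_pow, pow_mul, hφ, one_pow, mul_one] at hpow
  rw [map_one, hpow]

end TwistedPowers

section Isometries

variable {α β : Type*} [DecidableEq α] [DecidableEq β]

theorem norm_map_le {f : FreeGroup α →* FreeGroup β} (hf : ∀ i, (f (of i)).norm ≤ 1)
    (g : FreeGroup α) : (f g).norm ≤ g.norm := by
  have hword (L : List (α × Bool)) : (f (mk L)).norm ≤ L.length := by
    induction L with
    | nil => simp [← one_eq_mk]
    | cons x L ih =>
      have hx : (f (mk [x])).norm ≤ 1 := by
        rcases x with ⟨i, _ | _⟩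
        · rw [show mk [(i, false)] = (of i)⁻¹ from rfl, map_inv, norm_inv_eq]
          exact hf i
        · exact hf i
      have hmul : mk (x :: L) = mk [x] * mk L := by simp
      have := norm_mul_le (f (mk [x])) (f (mk L))
      rw [hmul, map_mul, List.length_cons]
      omega
  simpa only [mk_toWord, FreeGroup.norm] using hword g.toWord

variable (α) in
/-- The automorphisms preserving word length, that is, those permuting the letters `of i` and
`(of i)⁻¹`; they act by isometries fixing `1` on the Cayley tree. -/
def isometries : Subgroup (MulAut (FreeGroup α)) where
  carrier := {φ | ∀ g, (φ g).norm = g.norm}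
  mul_mem' hφ hψ g := (hφ _).trans (hψ g)
  one_mem' _ := rfl
  inv_mem' {φ} hφ g := by rw [← hφ, MulAut.apply_inv_self]

variable {φ : MulAut (FreeGroup α)} {w : FreeGroup α} {n : ℕ}

theorem mem_isometries_of_norm_le (h : ∀ i, (φ (of i)).norm ≤ 1)
    (h' : ∀ i, (φ⁻¹ (of i)).norm ≤ 1) : φ ∈ isometries α := by
  intro g
  refine le_antisymm (norm_map_le (f := φ.toMonoidHom) h g) ?_
  simpa using norm_map_le (f := (φ⁻¹).toMonoidHom) h' (φ g)

theorem norm_map (hφ : φ ∈ isometries α) (g : FreeGroup α) : (φ g).norm = g.norm := hφ g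

theorem gromovProduct_map (hφ : φ ∈ isometries α) (g h : FreeGroup α) :
    gromovProduct (φ g) (φ h) = gromovProduct g h := by
  have h₁ := norm_inv_mul_add g h
  have h₂ := norm_inv_mul_add (φ g) (φ h)
  rw [← map_inv, ← map_mul, norm_map hφ, norm_map hφ, norm_map hφ] at h₂
  omega

theorem IsPrefix.map {r g : FreeGroup α} (hφ : φ ∈ isometries α) (hr : IsPrefix r g) :
    IsPrefix (φ r) (φ g) := by
  rw [isPrefix_iff] at *
  rw [gromovProduct_map hφ, norm_map hφ, hr]

theorem norm_le_two_mul_gromovProduct (hφ : φ ∈ isometries α) (hn : n ≠ 0)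
    (h : twistedPow φ w n = 1) : w.norm ≤ 2 * gromovProduct w⁻¹ (φ w) := by
  by_contra! hlt
  -- Too little cancellation between consecutive factors makes the length grow.
  have hgrow (m : ℕ) : gromovProduct w⁻¹ (φ (twistedPow φ w (m + 1))) = gromovProduct w⁻¹ (φ w) ∧
      m < (twistedPow φ w (m + 1)).norm := by
    induction m with
    | zero =>
      simp only [twistedPow, map_one, mul_one, true_and]
      omega
    | succ m ih =>
      rw [twistedPow]
      have hnorm := norm_mul_add w (φ (twistedPow φ w (m + 1)))
      rw [norm_map hφ] at hnorm
      refine ⟨?_, by omega⟩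
      rw [map_mul]
      apply gromovProduct_mul_right
      rw [← map_inv, gromovProduct_map hφ, norm_map hφ, ih.1]
      omega
  obtain ⟨m, rfl⟩ := Nat.exists_eq_succ_of_ne_zero hn
  have := (hgrow m).2
  rw [h, FreeGroup.norm_one] at this
  omega

/-- If the last half of `w` cancels against the first half of `φ w`, then the first half of `w` is
`r` and the last half `(φ r)⁻¹`, up to a middle letter `m`. -/
theorem exists_eq_mul_mul_inv_map (hφ : φ ∈ isometries α)
    (h : w.norm ≤ 2 * gromovProduct w⁻¹ (φ w)) :
    ∃ r m, IsPrefix r w ∧ m.norm ≤ 1 ∧ φ m = m⁻¹ ∧ w = r * m * (φ r)⁻¹ := by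
  obtain ⟨r, hr, hrn⟩ := exists_isPrefix (g := w) (n := w.norm / 2) (by omega)
  obtain ⟨r', hr', hrn'⟩ := exists_isPrefix (g := w⁻¹) (n := w.norm / 2) (by
    rw [norm_inv_eq]; omega)
  obtain rfl : r' = φ r := hr'.eq_of_norm_eq (hr.map hφ) (by rw [hrn', norm_map hφ, hrn])
    (by omega)
  have hv : IsPrefix (w⁻¹ * r) w⁻¹ := hr.inv_mul_inv
  have hs : IsPrefix (w * φ r) w := by simpa using hr'.inv_mul_inv
  have hvn : (w⁻¹ * r).norm + w.norm / 2 = w.norm := by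
    rw [norm_inv_mul_comm, ← hrn, add_comm]; exact hr
  have hsn : (w * φ r).norm + w.norm / 2 = w.norm := by
    rw [IsPrefix, norm_inv_eq] at hr'
    rw [← norm_inv_eq, mul_inv_rev]; omega
  have hmid : φ (w * φ r) = w⁻¹ * r :=
    (hv.eq_of_norm_eq (hs.map hφ) (by rw [norm_map hφ]; omega) (by omega)).symm
  refine ⟨r, r⁻¹ * w * φ r, hr, ?_, ?_, by group⟩
  · have := hr.norm_inv_mul_mul hr' (by omega)
    omega
  · rw [mul_assoc, map_mul, hmid, map_inv]
    group

theorem two_mul_gromovProduct_inv_self_lt (hw : w ≠ 1) : 2 * gromovProduct w⁻¹ w < w.norm := by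
  by_contra! h
  obtain ⟨r, m, -, -, hm, hrm⟩ := exists_eq_mul_mul_inv_map (φ := 1) (one_mem _) h
  have hm1 : m = 1 := by
    rw [← sq_eq_one, sq]
    exact (congrArg (m * ·) hm).trans (mul_inv_cancel m)
  exact hw (by simpa [hm1] using hrm)

end Isometries

section Automorphisms

theorem hom_ext {H : Type*} [Group H] {f g : F2 →* H} (ha : f genA = g genA)
    (hb : f genB = g genB) : f = g := by
  ext i
  fin_cases i
  · exact ha
  · exact hb

theorem aut_ext {φ ψ : MulAut F2} (ha : φ genA = ψ genA) (hb : φ genB = ψ genB) : φ = ψ :=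
  MulEquiv.toMonoidHom_injective (hom_ext ha hb)

theorem endo_genA (u v : F2) : endo u v genA = u := by simp [endo, genA]

theorem endo_genB (u v : F2) : endo u v genB = v := by simp [endo, genB]

@[simp] theorem autP_genA : autP genA = genB := by
  rw [autP, MonoidHom.toMulEquiv_apply, endo_genA]

@[simp] theorem autP_genB : autP genB = genA := by
  rw [autP, MonoidHom.toMulEquiv_apply, endo_genB]

@[simp] theorem autX_genA : autX genA = genB⁻¹ := by
  rw [autX, MonoidHom.toMulEquiv_apply, endo_genA]

@[simp] theorem autX_genB : autX genB = genA := by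
  rw [autX, MonoidHom.toMulEquiv_apply, endo_genB]

@[simp] theorem autY_genA : autY genA = genA * genB⁻¹ := by
  rw [autY, MonoidHom.toMulEquiv_apply, endo_genA]

@[simp] theorem autY_genB : autY genB = genA := by
  rw [autY, MonoidHom.toMulEquiv_apply, endo_genB]

/-- The reflection `a ↦ a⁻¹`, `b ↦ b`. -/
def autE : MulAut F2 := autP * autX

@[simp] theorem autE_genA : autE genA = genA⁻¹ := by simp [autE]

@[simp] theorem autE_genB : autE genB = genB := by simp [autE]

/-- The transvection `a ↦ a`, `b ↦ b a`. -/
def autT : MulAut F2 :=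
  MonoidHom.toMulEquiv (endo genA (genB * genA)) (endo genA (genB * genA⁻¹))
    (by ext i; fin_cases i <;> simp [endo, genA, genB])
    (by ext i; fin_cases i <;> simp [endo, genA, genB])

@[simp] theorem autT_genA : autT genA = genA := by
  rw [autT, MonoidHom.toMulEquiv_apply, endo_genA]

@[simp] theorem autT_genB : autT genB = genB * genA := by
  rw [autT, MonoidHom.toMulEquiv_apply, endo_genB]

theorem autP_mul_self : autP * autP = 1 := aut_ext (by simp) (by simp)

theorem autE_mul_self : autE * autE = 1 := aut_ext (by simp) (by simp)

theorem mem_isometries_of_mul_self {φ : MulAut F2} (hφ : φ * φ = 1) (ha : (φ genA).norm ≤ 1)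
    (hb : (φ genB).norm ≤ 1) : φ ∈ isometries (Fin 2) := by
  have h : ∀ i, (φ (of i)).norm ≤ 1 := Fin.forall_fin_two.2 ⟨ha, hb⟩
  exact mem_isometries_of_norm_le h (by rwa [inv_eq_of_mul_eq_one_left hφ])

@[simp] theorem norm_genA : genA.norm = 1 := norm_of 0

@[simp] theorem norm_genB : genB.norm = 1 := norm_of 1

end Automorphisms

section Letters

variable {l m n : F2}

theorem norm_eq_one_iff {α : Type*} [DecidableEq α] {g : FreeGroup α} :
    g.norm = 1 ↔ ∃ i, g = of i ∨ g = (of i)⁻¹ := by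
  constructor
  · intro h
    obtain ⟨⟨i, s⟩, hi⟩ := List.length_eq_one_iff.1 h
    refine ⟨i, ?_⟩
    rw [← mk_toWord (x := g), hi]
    cases s
    · exact Or.inr rfl
    · exact Or.inl rfl
  · rintro ⟨i, rfl | rfl⟩ <;> simp

theorem ne_one_of_norm_eq_one (hl : l.norm = 1) : l ≠ 1 := by
  rintro rfl
  simp at hl

theorem mul_self_ne_one (hl : l.norm = 1) : l * l ≠ 1 := by
  rw [← sq, Ne, sq_eq_one]
  exact ne_one_of_norm_eq_one hl

theorem eq_gen_or_inv_gen (hl : l.norm = 1) : l = genA ∨ l = genA⁻¹ ∨ l = genB ∨ l = genB⁻¹ := by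
  have := norm_eq_one_iff.1 hl
  rwa [Fin.exists_fin_two, or_assoc] at this

/-- A free basis of `F₂` consisting of two letters. -/
structure IsLetterBasis (l m : F2) : Prop where
  norm_left : l.norm = 1
  norm_right : m.norm = 1
  ne : l ≠ m
  mul_ne_one : l * m ≠ 1

theorem IsLetterBasis.inv_inv (h : IsLetterBasis l m) : IsLetterBasis m⁻¹ l⁻¹ where
  norm_left := norm_inv_eq.trans h.norm_right
  norm_right := norm_inv_eq.trans h.norm_left
  ne := fun e => h.ne (inv_injective e).symm
  mul_ne_one := fun e => h.mul_ne_one (by rwa [← mul_inv_rev, inv_eq_one] at e)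

theorem closure_autP_autE_le_isometries :
    Subgroup.closure {autP, autE} ≤ isometries (Fin 2) := by
  rw [Subgroup.closure_le, Set.pair_subset_iff]
  exact ⟨mem_isometries_of_mul_self autP_mul_self (by simp) (by simp),
    mem_isometries_of_mul_self autE_mul_self (by simp) (by simp)⟩

theorem IsLetterBasis.exists_signed_permutation (h : IsLetterBasis l m) :
    ∃ d ∈ Subgroup.closure {autP, autE}, d genA = l ∧ d genB = m := by
  have hP : autP ∈ Subgroup.closure {autP, autE} := Subgroup.subset_closure (by simp)
  have hE : autE ∈ Subgroup.closure {autP, autE} := Subgroup.subset_closure (by simp)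
  obtain ⟨hl, hm, hne, hmul⟩ := h
  rcases eq_gen_or_inv_gen hl with rfl | rfl | rfl | rfl <;>
    rcases eq_gen_or_inv_gen hm with rfl | rfl | rfl | rfl
  any_goals exact absurd rfl hne
  any_goals exact absurd (mul_inv_cancel _) hmul
  · exact ⟨1, one_mem _, by simp⟩
  · exact ⟨autP * autE * autP, mul_mem (mul_mem hP hE) hP, by simp⟩
  · exact ⟨autE, hE, by simp⟩
  · exact ⟨autE * (autP * autE * autP), mul_mem hE (mul_mem (mul_mem hP hE) hP), by simp⟩
  · exact ⟨autP, hP, by simp⟩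
  · exact ⟨autE * autP, mul_mem hE hP, by simp⟩
  · exact ⟨autP * autE, mul_mem hP hE, by simp⟩
  · exact ⟨autE * autP * autE, mul_mem (mul_mem hE hP) hE, by simp⟩

theorem isLetterBasis_map {φ : MulAut F2} (hA : (φ genA).norm = 1) (hB : (φ genB).norm = 1) :
    IsLetterBasis (φ genA) (φ genB) where
  norm_left := hA
  norm_right := hB
  ne e := absurd (of_injective (φ.injective e)) (by decide)
  mul_ne_one e := by
    rw [← map_mul, map_eq_one_iff _ φ.injective] at e
    exact absurd e (by decide)

theorem mem_closure_autP_autE {φ : MulAut F2} (hA : (φ genA).norm = 1) (hB : (φ genB).norm = 1) :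
    φ ∈ Subgroup.closure {autP, autE} := by
  obtain ⟨d, hd, hdA, hdB⟩ := (isLetterBasis_map hA hB).exists_signed_permutation
  rwa [← aut_ext hdA hdB]

theorem isometries_eq_closure : isometries (Fin 2) = Subgroup.closure {autP, autE} :=
  le_antisymm (fun _ hφ => mem_closure_autP_autE ((norm_map hφ _).trans norm_genA)
    ((norm_map hφ _).trans norm_genB)) closure_autP_autE_le_isometries

theorem IsLetterBasis.exists_isometry (h : IsLetterBasis l m) :
    ∃ d ∈ isometries (Fin 2), d genA = l ∧ d genB = m :=
  isometries_eq_closure ▸ h.exists_signed_permutation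

theorem IsLetterBasis.eq_or_inv (h : IsLetterBasis l m) (hn : n.norm = 1) :
    n = l ∨ n = l⁻¹ ∨ n = m ∨ n = m⁻¹ := by
  obtain ⟨d, hd, rfl, rfl⟩ := h.exists_isometry
  have := eq_gen_or_inv_gen ((norm_map (inv_mem hd) n).trans hn)
  simpa only [MulAut.inv_apply, MulEquiv.symm_apply_eq, map_inv] using this

end Letters

section Nielsen

/-- The group of inner automorphisms. -/
abbrev Inn : Subgroup (MulAut F2) := (MulAut.conj (G := F2)).range

/-- The automorphisms that are inner up to a signed permutation of the letters. -/
abbrev innIsom : Subgroup (MulAut F2) := Inn ⊔ isometries (Fin 2)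

/-- The automorphisms generated by the inner ones, the signed permutations of the letters
and a transvection. -/
def elementary : Subgroup (MulAut F2) := innIsom ⊔ Subgroup.zpowers autT

variable {l m n : F2}

theorem conj_mem_elementary (u : F2) : MulAut.conj u ∈ elementary :=
  Subgroup.mem_sup_left (Subgroup.mem_sup_left ⟨u, rfl⟩)

theorem isometries_le_elementary : isometries (Fin 2) ≤ elementary :=
  le_sup_right.trans le_sup_left

theorem IsLetterBasis.exists_transvection (h : IsLetterBasis l m) :
    ∃ t ∈ elementary, t l = l * m ∧ t m = m := by
  have hm : IsLetterBasis m l :=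
    ⟨h.norm_right, h.norm_left, h.ne.symm, fun e => h.mul_ne_one (mul_eq_one_comm.1 e)⟩
  obtain ⟨d, hd, rfl, rfl⟩ := hm.exists_isometry
  have hd' := isometries_le_elementary hd
  refine ⟨d * autT * d⁻¹, mul_mem (mul_mem hd' ?_) (inv_mem hd'), by simp, by simp⟩
  exact Subgroup.mem_sup_right (Subgroup.mem_zpowers autT)

/-- The total length of the images of the standard basis, the complexity of Nielsen's algorithm. -/
def size (ψ : MulAut F2) : ℕ := (ψ genA).norm + (ψ genB).norm

theorem IsLetterBasis.size_eq (h : IsLetterBasis l m) (ψ : MulAut F2) :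
    size ψ = (ψ l).norm + (ψ m).norm := by
  obtain ⟨hl, hm, hne, hmul⟩ := h
  rcases eq_gen_or_inv_gen hl with rfl | rfl | rfl | rfl <;>
    rcases eq_gen_or_inv_gen hm with rfl | rfl | rfl | rfl
  any_goals exact absurd rfl hne
  any_goals exact absurd (mul_inv_cancel _) hmul
  all_goals simp only [size, map_inv, norm_inv_eq, add_comm]

/-- An automorphism whose size no elementary automorphism can decrease. -/
def IsMinimal (ψ : MulAut F2) : Prop := ∀ k ∈ elementary, size ψ ≤ size (ψ * k)

namespace IsMinimal

variable {ψ : MulAut F2}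

theorem two_mul_gromovProduct_le_right (hψ : IsMinimal ψ) (h : IsLetterBasis l m) :
    2 * gromovProduct (ψ l)⁻¹ (ψ m) ≤ (ψ m).norm := by
  obtain ⟨t, ht, htl, htm⟩ := h.exists_transvection
  have hsize := hψ t ht
  rw [h.size_eq, h.size_eq, MulAut.mul_apply, MulAut.mul_apply, htl, htm, map_mul] at hsize
  have := norm_mul_add (ψ l) (ψ m)
  omega

theorem two_mul_gromovProduct_le_left (hψ : IsMinimal ψ) (h : IsLetterBasis l m) :
    2 * gromovProduct (ψ l)⁻¹ (ψ m) ≤ (ψ l).norm := by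
  have := hψ.two_mul_gromovProduct_le_right h.inv_inv
  rwa [map_inv, map_inv, norm_inv_eq, inv_inv, gromovProduct_comm] at this

/-- Otherwise `ψ m = q r⁻¹` and `ψ l = r ⋯ q⁻¹`, and conjugating the pair `ψ (l m), ψ m` by `r`
decreases the total length. -/
theorem not_half_cancel_half_cancel (hψ : IsMinimal ψ) (h : IsLetterBasis l m) {k : ℕ} (hk : 0 < k)
    (hm : (ψ m).norm = 2 * k) (h₁ : k ≤ gromovProduct (ψ l)⁻¹ (ψ m)) :
    ¬k ≤ gromovProduct (ψ m)⁻¹ (ψ l) := by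
  intro h₂
  have hl := hψ.two_mul_gromovProduct_le_left h
  obtain ⟨q, hq, hqn⟩ := exists_isPrefix (g := ψ m) (n := k) (by omega)
  obtain ⟨r, hr, hrn, hqr⟩ : ∃ r, IsPrefix r (ψ m)⁻¹ ∧ r.norm = k ∧ ψ m * r = q := by
    refine ⟨(ψ m)⁻¹ * q, hq.inv_mul_inv, ?_, by group⟩
    rw [norm_inv_mul_comm]
    rw [IsPrefix] at hq
    omega
  have hql : IsPrefix q (ψ l)⁻¹ :=
    hq.of_norm_le_gromovProduct (gromovProduct_comm _ (ψ m) ▸ hqn.trans_le h₁)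
  have hrl : IsPrefix r (ψ l) := hr.of_norm_le_gromovProduct (hrn.trans_le h₂)
  have hlq := hrl.norm_inv_mul_mul hql (by omega)
  have hmq := norm_mul_le r⁻¹ q
  rw [norm_inv_eq] at hmq
  obtain ⟨t, ht, htl, htm⟩ := h.exists_transvection
  have hsize := hψ (MulAut.conj (ψ⁻¹ r⁻¹) * t) (mul_mem (conj_mem_elementary _) ht)
  rw [← mul_assoc, mul_conj, MulAut.apply_inv_self, h.size_eq ψ, h.size_eq] at hsize
  have hconj_l : (MulAut.conj r⁻¹ * ψ * t) l = r⁻¹ * ψ l * q := by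
    simp [htl, ← hqr, mul_assoc]
  have hconj_m : (MulAut.conj r⁻¹ * ψ * t) m = r⁻¹ * q := by
    simp [htm, ← hqr, mul_assoc]
  rw [hconj_l, hconj_m] at hsize
  omega

theorem two_mul_gromovProduct_le (hψ : IsMinimal ψ) (hl : l.norm = 1) (hm : m.norm = 1)
    (hlm : l * m ≠ 1) :
    2 * gromovProduct (ψ l)⁻¹ (ψ m) ≤ (ψ l).norm ∧
      2 * gromovProduct (ψ l)⁻¹ (ψ m) ≤ (ψ m).norm ∧
      (l = m → 2 * gromovProduct (ψ l)⁻¹ (ψ m) < (ψ m).norm) := by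
  by_cases h : l = m
  · subst h
    have := two_mul_gromovProduct_inv_self_lt
      ((map_ne_one_iff ψ ψ.injective).2 (ne_one_of_norm_eq_one hl))
    exact ⟨this.le, this.le, fun _ => this⟩
  · exact ⟨hψ.two_mul_gromovProduct_le_left ⟨hl, hm, h, hlm⟩,
      hψ.two_mul_gromovProduct_le_right ⟨hl, hm, h, hlm⟩, fun e => absurd e h⟩

theorem gromovProduct_add_lt (hψ : IsMinimal ψ) (hl : l.norm = 1) (hm : m.norm = 1)
    (hn : n.norm = 1) (hlm : l * m ≠ 1) (hmn : m * n ≠ 1) :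
    gromovProduct (ψ l)⁻¹ (ψ m) + gromovProduct (ψ m)⁻¹ (ψ n) < (ψ m).norm := by
  obtain ⟨-, hlm₂, hlm₃⟩ := hψ.two_mul_gromovProduct_le hl hm hlm
  obtain ⟨hmn₁, -, hmn₃⟩ := hψ.two_mul_gromovProduct_le hm hn hmn
  have hpos := two_mul_gromovProduct_inv_self_lt
    ((map_ne_one_iff ψ ψ.injective).2 (ne_one_of_norm_eq_one hm))
  by_contra! hle
  have hne : l ≠ m := fun e => by have := hlm₃ e; omega
  have hne' : m ≠ n := fun e => by
    subst e
    omega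
  have hb : IsLetterBasis l m := ⟨hl, hm, hne, hlm⟩
  rcases hb.eq_or_inv hn with rfl | rfl | rfl | rfl
  · exact hψ.not_half_cancel_half_cancel hb (k := gromovProduct (ψ n)⁻¹ (ψ m)) (by omega)
      (by omega) le_rfl (by omega)
  · -- `ψ l` cancels against both ends of `ψ m`, which would make `ψ m` start and end inversely.
    rw [map_inv] at *
    have := le_gromovProduct_trans (g := (ψ m)⁻¹) (h := (ψ l)⁻¹) (k := ψ m)
      (n := gromovProduct (ψ l)⁻¹ (ψ m)) (by omega) le_rfl
    omega
  · exact hne' rfl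
  · exact hmn (mul_inv_cancel m)

/-- No letter of `ψ k`, `ψ l`, … is cancelled from both sides, so each contributes to the length. -/
theorem gromovProduct_map_mul (hψ : IsMinimal ψ) (w : F2) :
    ∀ k l : F2, k.norm = 1 → l.norm = 1 → k * l ≠ 1 → (l * w).norm = w.norm + 1 →
      gromovProduct (ψ k)⁻¹ (ψ (l * w)) = gromovProduct (ψ k)⁻¹ (ψ l) ∧
      gromovProduct (ψ k)⁻¹ (ψ l) + w.norm < (ψ (l * w)).norm := by
  induction hw : w.norm generalizing w with
  | zero =>
    intro k l hk hl hkl _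
    obtain rfl := FreeGroup.norm_eq_zero.1 hw
    have := hψ.gromovProduct_add_lt hk hl hl hkl (mul_self_ne_one hl)
    rw [mul_one]
    exact ⟨rfl, by omega⟩
  | succ c ih =>
    intro k l hk hl hkl hlw
    obtain ⟨m, hm, hm1⟩ := exists_isPrefix (g := w) (n := 1) (by omega)
    obtain ⟨v, rfl⟩ : ∃ v, w = m * v := ⟨m⁻¹ * w, by group⟩
    rw [IsPrefix, inv_mul_cancel_left] at hm
    have hlm : l * m ≠ 1 := fun e => by
      rw [← mul_assoc, e, one_mul] at hlw
      omega
    obtain ⟨heq, hlt⟩ := ih v (by omega) l m hl hm1 hlm (by omega)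
    have hadd := hψ.gromovProduct_add_lt hk hl hm1 hkl hlm
    have hnorm := norm_mul_add (ψ l) (ψ (m * v))
    rw [map_mul ψ l]
    refine ⟨gromovProduct_mul_right (by omega), by omega⟩

theorem norm_le_norm_map (hψ : IsMinimal ψ) (w : F2) : w.norm ≤ (ψ w).norm := by
  rcases Nat.eq_zero_or_pos w.norm with h | h
  · omega
  obtain ⟨l, hl, hl1⟩ := exists_isPrefix (g := w) (n := 1) h
  obtain ⟨v, rfl⟩ : ∃ v, w = l * v := ⟨l⁻¹ * w, by group⟩
  rw [IsPrefix, inv_mul_cancel_left] at hl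
  have := (hψ.gromovProduct_map_mul v l l hl1 hl1 (mul_self_ne_one hl1) (by omega)).2
  omega

theorem mem_isometries (hψ : IsMinimal ψ) : ψ ∈ isometries (Fin 2) := by
  have hletter (g : F2) (hg : g.norm = 1) : (ψ⁻¹ g).norm = 1 := by
    have hle := hψ.norm_le_norm_map (ψ⁻¹ g)
    have hne : (ψ⁻¹ g).norm ≠ 0 := by
      rw [Ne, FreeGroup.norm_eq_zero, map_eq_one_iff _ (MulEquiv.injective _)]
      exact ne_one_of_norm_eq_one hg
    rw [MulAut.apply_inv_self] at hle
    omega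
  rw [← inv_mem_iff]
  exact closure_autP_autE_le_isometries
    (mem_closure_autP_autE (hletter _ norm_genA) (hletter _ norm_genB))

end IsMinimal

theorem elementary_eq_top : elementary = ⊤ := by
  rw [eq_top_iff]
  intro φ _
  induction hn : size φ using Nat.strong_induction_on generalizing φ with
  | _ n ih =>
    subst hn
    by_cases hmin : IsMinimal φ
    · exact isometries_le_elementary hmin.mem_isometries
    · simp only [IsMinimal, not_forall, not_le] at hmin
      obtain ⟨k, hk, hlt⟩ := hmin
      exact (mul_mem_cancel_right hk).1 (ih _ hlt (Subgroup.mem_top _) rfl)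

end Nielsen

open scoped Pointwise

section Abelianization

/-- The exponent sum of a generator, as a homomorphism. -/
def exponentHom (i : Fin 2) : F2 →* Multiplicative ℤ :=
  FreeGroup.lift fun j => Multiplicative.ofAdd (if i = j then 1 else 0)

/-- The exponent sum of a generator, i.e. a coordinate of the image of a word in `ℤ²`. -/
def exponent (i : Fin 2) (w : F2) : ℤ := Multiplicative.toAdd (exponentHom i w)

variable (i : Fin 2) (u v w : F2)

@[simp] theorem exponent_one : exponent i 1 = 0 := by simp [exponent]

@[simp] theorem exponent_mul : exponent i (u * v) = exponent i u + exponent i v := by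
  simp [exponent]

@[simp] theorem exponent_inv : exponent i u⁻¹ = -exponent i u := by simp [exponent]

@[simp] theorem exponent_genA : exponent i genA = if i = 0 then 1 else 0 := by
  simp [exponent, exponentHom, genA]

@[simp] theorem exponent_genB : exponent i genB = if i = 1 then 1 else 0 := by
  simp [exponent, exponentHom, genB]

theorem exponent_map (φ : MulAut F2) :
    exponent i (φ w) = exponent i (φ genA) * exponent 0 w + exponent i (φ genB) * exponent 1 w := by
  induction w using FreeGroup.induction_on with
  | C1 => simp
  | of j =>
    fin_cases j
    · change exponent i (φ genA) = _ * exponent 0 genA + _ * exponent 1 genA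
      simp
    · change exponent i (φ genB) = _ * exponent 0 genB + _ * exponent 1 genB
      simp
  | inv_of j h => simp only [map_inv, exponent_inv, h]; ring
  | mul u v hu hv => simp only [map_mul, exponent_mul, hu, hv]; ring

/-- The action of an automorphism on the abelianization `ℤ²`. -/
def toMat : MulAut F2 →* Matrix (Fin 2) (Fin 2) ℤ where
  toFun φ := !![exponent 0 (φ genA), exponent 0 (φ genB); exponent 1 (φ genA), exponent 1 (φ genB)]
  map_one' := by simp [Matrix.one_fin_two]
  map_mul' φ ψ := by simp only [MulAut.mul_apply, exponent_map _ (ψ _) φ, Matrix.mul_fin_two]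

theorem toMat_apply (φ : MulAut F2) :
    toMat φ =
      !![exponent 0 (φ genA), exponent 0 (φ genB); exponent 1 (φ genA), exponent 1 (φ genB)] :=
  rfl

@[simp] theorem toMat_conj : toMat (MulAut.conj u) = 1 := by
  simp [toMat_apply, Matrix.one_fin_two]

@[simp] theorem toMat_autP : toMat autP = !![0, 1; 1, 0] := by simp [toMat_apply]

@[simp] theorem toMat_autE : toMat autE = !![-1, 0; 0, 1] := by simp [toMat_apply]

@[simp] theorem toMat_autT : toMat autT = !![1, 1; 0, 1] := by simp [toMat_apply]

variable {l : F2} {δ : MulAut F2}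

theorem exponent_add_exponent_le_one (hl : l.norm = 1) : exponent 0 l + exponent 1 l ≤ 1 := by
  rcases eq_gen_or_inv_gen hl with rfl | rfl | rfl | rfl <;> simp

theorem eq_one_of_mem_isometries_of_toMat_eq_one (hδ : δ ∈ isometries (Fin 2))
    (h : toMat δ = 1) : δ = 1 := by
  rw [toMat_apply, Matrix.one_fin_two] at h
  have h00 : exponent 0 (δ genA) = 1 := congrFun (congrFun h 0) 0
  have h11 : exponent 1 (δ genB) = 1 := congrFun (congrFun h 1) 1
  apply aut_ext
  · rcases eq_gen_or_inv_gen ((norm_map hδ _).trans norm_genA) with e | e | e | e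
    · exact e
    all_goals simp [e] at h00
  · rcases eq_gen_or_inv_gen ((norm_map hδ _).trans norm_genB) with e | e | e | e
    on_goal 3 => exact e
    all_goals simp [e] at h11

end Abelianization

section DoubleCosets

variable {G : Type*} [Group G] {D : Subgroup G} {S : Set G}

theorem mul_mem_double_coset {M : Set G} {d g : G} (hd : d ∈ D) (hg : g ∈ (D : Set G) * M * D) :
    d * g ∈ (D : Set G) * M * D := by
  obtain ⟨_, ⟨d₁, hd₁, m, hm, rfl⟩, d₂, hd₂, rfl⟩ := hg
  exact ⟨_, ⟨_, mul_mem hd hd₁, m, hm, rfl⟩, d₂, hd₂, by simp only [mul_assoc]⟩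

theorem inv_mul_mem_double_coset (hinv : S⁻¹ ⊆ (D : Set G) * S * D)
    (hdiv : ∀ r ∈ S, ∀ s ∈ S, r ≠ s → s⁻¹ * r ∈ (D : Set G) * S) {s n : G} (hs : s ∈ S)
    (hn : n ∈ Submonoid.closure S) : s⁻¹ * n ∈ (D : Set G) * Submonoid.closure S * D := by
  induction hn using Submonoid.closure_induction_left with
  | one =>
    rw [mul_one]
    exact Set.mul_subset_mul_right (Set.mul_subset_mul_left Submonoid.subset_closure)
      (hinv (Set.inv_mem_inv.2 hs))
  | mul_left r hr m hm =>
    by_cases hrs : r = s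
    · exact ⟨_, ⟨1, one_mem D, m, hm, rfl⟩, 1, one_mem D, by simp [hrs]⟩
    · obtain ⟨d, hd, t, ht, e : d * t = s⁻¹ * r⟩ := hdiv r hr s hs hrs
      refine ⟨_, ⟨d, hd, t * m, mul_mem (Submonoid.subset_closure ht) hm, rfl⟩, 1, one_mem D, ?_⟩
      simp only [← mul_assoc, mul_one, e]

/-- If `D` permutes the letters `S ∪ S⁻¹` up to left multiplication by `D`, then a word in `D` and
`S` can be made positive by pushing `D` to the outside and cancelling the negative letters. -/
theorem mem_double_coset_of_mem_sup_closure (hcomm : (S ∪ S⁻¹) * (D : Set G) ⊆ D * (S ∪ S⁻¹))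
    (hinv : S⁻¹ ⊆ (D : Set G) * S * D) (hdiv : ∀ r ∈ S, ∀ s ∈ S, r ≠ s → s⁻¹ * r ∈ (D : Set G) * S)
    {g : G} (hg : g ∈ D ⊔ Subgroup.closure S) : g ∈ (D : Set G) * Submonoid.closure S * D := by
  have mul_mem_of_letter : ∀ s ∈ S ∪ S⁻¹, ∀ h ∈ (D : Set G) * Submonoid.closure S * D,
      s * h ∈ (D : Set G) * Submonoid.closure S * D := by
    rintro s hs _ ⟨_, ⟨d₁, hd₁, n, hn, rfl⟩, d₂, hd₂, rfl⟩
    obtain ⟨d, hd, r, hr, e : d * r = s * d₁⟩ := hcomm ⟨s, hs, d₁, hd₁, rfl⟩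
    have hrn : r * n ∈ (D : Set G) * Submonoid.closure S * D := by
      rcases hr with hr | hr
      · exact ⟨_, ⟨1, one_mem D, _, mul_mem (Submonoid.subset_closure hr) hn, rfl⟩, 1, one_mem D,
          by simp only [one_mul, mul_one]⟩
      · simpa only [inv_inv] using inv_mul_mem_double_coset hinv hdiv hr hn
    obtain ⟨k, hk, d₃, hd₃, e' : k * d₃ = d * (r * n)⟩ := mul_mem_double_coset hd hrn
    refine ⟨k, hk, d₃ * d₂, mul_mem hd₃ hd₂, ?_⟩
    simp only [← mul_assoc] at e' ⊢
    rw [e', e]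
  have mul_mem_of_gen : ∀ s ∈ (D : Set G) ∪ S, ∀ h ∈ (D : Set G) * Submonoid.closure S * D,
      s * h ∈ (D : Set G) * Submonoid.closure S * D ∧
        s⁻¹ * h ∈ (D : Set G) * Submonoid.closure S * D := by
    rintro s (hs | hs) h hh
    · exact ⟨mul_mem_double_coset hs hh, mul_mem_double_coset (inv_mem hs) hh⟩
    · exact ⟨mul_mem_of_letter s (Or.inl hs) h hh,
        mul_mem_of_letter _ (Or.inr (Set.inv_mem_inv.2 hs)) h hh⟩
  replace hg : g ∈ Subgroup.closure ((D : Set G) ∪ S) := by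
    rwa [Subgroup.closure_union, Subgroup.closure_eq]
  induction hg using Subgroup.closure_induction_left with
  | one => exact ⟨1, ⟨1, one_mem D, 1, one_mem _, mul_one 1⟩, 1, one_mem D, mul_one 1⟩
  | mul_left s hs h _ ih => exact (mul_mem_of_gen s hs h ih).1
  | inv_mul_cancel s hs h _ ih => exact (mul_mem_of_gen s hs h ih).2

end DoubleCosets

section Kernel

/-- The two elementary transvections `a ↦ a, b ↦ ba` and `a ↦ ab, b ↦ b`, which act on `ℤ²` by
nonnegative matrices. -/
def transvections : Set (MulAut F2) := {autT, autP * autT * autP}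

instance : Inn.Normal := by
  constructor
  rintro _ ⟨u, rfl⟩ φ
  exact ⟨φ u, by rw [mul_conj, mul_inv_cancel_right]⟩

theorem mem_innIsom_iff {φ : MulAut F2} :
    φ ∈ innIsom ↔ ∃ u, ∃ δ ∈ isometries (Fin 2), MulAut.conj u * δ = φ := by
  rw [Subgroup.mem_sup_of_normal_left]
  simp only [MonoidHom.mem_range, exists_exists_eq_and]

theorem autP_mem_isometries : autP ∈ isometries (Fin 2) :=
  mem_isometries_of_mul_self autP_mul_self (by simp) (by simp)

theorem autE_mem_isometries : autE ∈ isometries (Fin 2) :=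
  mem_isometries_of_mul_self autE_mul_self (by simp) (by simp)

theorem conj_mem_innIsom (u : F2) : MulAut.conj u ∈ innIsom :=
  Subgroup.mem_sup_left ⟨u, rfl⟩

theorem autP_mem_innIsom : autP ∈ innIsom := Subgroup.mem_sup_right autP_mem_isometries

theorem autE_mem_innIsom : autE ∈ innIsom := Subgroup.mem_sup_right autE_mem_isometries

theorem transvection_mul_autP {σ : MulAut F2} (hσ : σ ∈ transvections ∪ transvections⁻¹) :
    ∃ τ ∈ transvections ∪ transvections⁻¹, autP * τ = σ * autP := by
  refine ⟨autP * σ * autP, ?_, by simp only [← mul_assoc, autP_mul_self, one_mul]⟩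
  have hP : autP⁻¹ = autP := inv_eq_of_mul_eq_one_left autP_mul_self
  have hconj : ∀ τ ∈ transvections, autP * τ * autP ∈ transvections := by
    rintro _ (rfl | rfl)
    · exact Or.inr rfl
    · left
      simp only [mul_assoc, autP_mul_self, mul_one]
      simp only [← mul_assoc, autP_mul_self, one_mul]
  rcases hσ with hσ | hσ
  · exact Or.inl (hconj σ hσ)
  · right
    simpa only [Set.mem_inv, mul_inv_rev, hP, mul_assoc] using hconj _ hσ

theorem transvection_mul_autE {σ : MulAut F2} (hσ : σ ∈ transvections ∪ transvections⁻¹) :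
    ∃ u, ∃ τ ∈ transvections ∪ transvections⁻¹, MulAut.conj u * autE * τ = σ * autE := by
  rcases hσ with (rfl | rfl) | (hσ | hσ)
  · refine ⟨1, autT⁻¹, Or.inr (Or.inl (inv_inv _)), ?_⟩
    rw [mul_inv_eq_iff_eq_mul]
    exact aut_ext (by simp) (by simp)
  · refine ⟨genB⁻¹, (autP * autT * autP)⁻¹, Or.inr (Or.inr (inv_inv _)), ?_⟩
    rw [mul_inv_eq_iff_eq_mul]
    exact aut_ext (by simp [mul_assoc]) (by simp)
  · obtain rfl := inv_eq_iff_eq_inv.1 hσ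
    refine ⟨1, autT, Or.inl (Or.inl rfl), ?_⟩
    rw [eq_inv_mul_iff_mul_eq]
    exact aut_ext (by simp) (by simp)
  · obtain rfl := inv_eq_iff_eq_inv.1 hσ
    refine ⟨genB, autP * autT * autP, Or.inl (Or.inr rfl), ?_⟩
    rw [eq_inv_mul_iff_mul_eq]
    exact aut_ext (by simp [mul_assoc]) (by simp)

theorem transvection_mul_of_mem {σ ε : MulAut F2} (hσ : σ ∈ transvections ∪ transvections⁻¹)
    (hε : ε ∈ ({autP, autE} : Set (MulAut F2))) :
    ∃ φ ∈ innIsom, ∃ τ ∈ transvections ∪ transvections⁻¹, φ * τ = σ * ε := by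
  rcases hε with rfl | rfl
  · exact ⟨autP, autP_mem_innIsom, transvection_mul_autP hσ⟩
  · obtain ⟨u, h⟩ := transvection_mul_autE hσ
    exact ⟨_, mul_mem (conj_mem_innIsom u) autE_mem_innIsom, h⟩

theorem transvection_mul_isometry {σ δ : MulAut F2} (hσ : σ ∈ transvections ∪ transvections⁻¹)
    (hδ : δ ∈ isometries (Fin 2)) :
    ∃ φ ∈ innIsom, ∃ τ ∈ transvections ∪ transvections⁻¹, φ * τ = σ * δ := by
  rw [isometries_eq_closure] at hδ
  have mul_gen : ∀ ε ∈ ({autP, autE} : Set (MulAut F2)), ∀ ψ,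
      (∃ φ ∈ innIsom, ∃ τ ∈ transvections ∪ transvections⁻¹, φ * τ = σ * ψ) →
      ∃ φ ∈ innIsom, ∃ τ ∈ transvections ∪ transvections⁻¹, φ * τ = σ * (ψ * ε) := by
    rintro ε hε ψ ⟨φ, hφ, τ, hτ, e⟩
    obtain ⟨χ, hχ, ρ, hρ, e'⟩ := transvection_mul_of_mem hτ hε
    exact ⟨φ * χ, mul_mem hφ hχ, ρ, hρ, by rw [mul_assoc, e', ← mul_assoc, e, mul_assoc]⟩
  induction hδ using Subgroup.closure_induction_right with
  | one => exact ⟨1, one_mem _, σ, hσ, by rw [one_mul, mul_one]⟩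
  | mul_right ψ _ ε hε ih => exact mul_gen ε hε ψ ih
  | mul_inv_cancel ψ _ ε hε ih =>
    have hinv : ε⁻¹ = ε := by
      rcases hε with rfl | rfl
      · exact inv_eq_of_mul_eq_one_left autP_mul_self
      · exact inv_eq_of_mul_eq_one_left autE_mul_self
    rw [hinv]
    exact mul_gen ε hε ψ ih

theorem transvections_mul_innIsom_subset :
    (transvections ∪ transvections⁻¹) * (innIsom : Set (MulAut F2)) ⊆
      innIsom * (transvections ∪ transvections⁻¹) := by
  rintro _ ⟨σ, hσ, φ, hφ, rfl⟩
  obtain ⟨u, δ, hδ, rfl⟩ := mem_innIsom_iff.1 hφ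
  obtain ⟨φ, hφ, τ, hτ, e⟩ := transvection_mul_isometry hσ hδ
  refine ⟨MulAut.conj (σ u) * φ, mul_mem (conj_mem_innIsom _) hφ, τ, hτ, ?_⟩
  simp only [← mul_assoc, mul_conj]
  rw [mul_assoc, e, mul_assoc]

theorem inv_transvections_subset :
    transvections⁻¹ ⊆ (innIsom : Set (MulAut F2)) * transvections * innIsom := by
  intro σ hσ
  have hT : autE * autT * autE = autT⁻¹ :=
    eq_inv_of_mul_eq_one_left (aut_ext (by simp) (by simp))
  rcases hσ with hσ | hσ
  · obtain rfl := inv_eq_iff_eq_inv.1 hσ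
    exact ⟨_, ⟨_, autE_mem_innIsom, _, Or.inl rfl, rfl⟩, _, autE_mem_innIsom, hT⟩
  · obtain rfl := inv_eq_iff_eq_inv.1 hσ
    refine ⟨_, ⟨_, mul_mem autP_mem_innIsom autE_mem_innIsom, _, Or.inl rfl, rfl⟩, _,
      mul_mem autE_mem_innIsom autP_mem_innIsom, ?_⟩
    have hP : autP⁻¹ = autP := inv_eq_of_mul_eq_one_left autP_mul_self
    simp only [mul_inv_rev, hP, ← hT, mul_assoc]

theorem inv_mul_transvection_mem {σ τ : MulAut F2} (hσ : σ ∈ transvections) (hτ : τ ∈ transvections)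
    (hne : σ ≠ τ) : τ⁻¹ * σ ∈ (innIsom : Set (MulAut F2)) * transvections := by
  rcases hσ with rfl | rfl <;> rcases hτ with rfl | rfl
  · exact absurd rfl hne
  · refine ⟨MulAut.conj genB * (autP * autE), mul_mem (conj_mem_innIsom _)
      (mul_mem autP_mem_innIsom autE_mem_innIsom), _, Or.inr rfl, eq_inv_mul_iff_mul_eq.2 ?_⟩
    exact aut_ext (by simp) (by simp [mul_assoc])
  · refine ⟨MulAut.conj genA * (autE * autP), mul_mem (conj_mem_innIsom _)
      (mul_mem autE_mem_innIsom autP_mem_innIsom), _, Or.inl rfl, eq_inv_mul_iff_mul_eq.2 ?_⟩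
    exact aut_ext (by simp [mul_assoc]) (by simp)
  · exact absurd rfl hne

theorem toMat_transvection_mul {σ φ : MulAut F2} (hσ : σ ∈ transvections) :
    (∀ j, toMat (σ * φ) 0 j = toMat φ 0 j + toMat φ 1 j ∧ toMat (σ * φ) 1 j = toMat φ 1 j) ∨
      ∀ j, toMat (σ * φ) 0 j = toMat φ 0 j ∧ toMat (σ * φ) 1 j = toMat φ 0 j + toMat φ 1 j := by
  rcases hσ with rfl | rfl
  · left
    simp [Matrix.mul_apply]
  · right
    simp [Matrix.mul_apply]

theorem toMat_of_mem_closure_transvections {φ : MulAut F2}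
    (hφ : φ ∈ Submonoid.closure transvections) :
    (∀ i j, 0 ≤ toMat φ i j) ∧ (∀ i, 1 ≤ toMat φ i 0 + toMat φ i 1) ∧
      (φ = 1 ∨ 3 ≤ toMat φ 0 0 + toMat φ 0 1 + (toMat φ 1 0 + toMat φ 1 1)) := by
  induction hφ using Submonoid.closure_induction_left with
  | one => simp [Fin.forall_fin_two]
  | mul_left σ hσ φ _ ih =>
    simp only [Fin.forall_fin_two] at ih
    have := toMat_transvection_mul (φ := φ) hσ
    simp only [Fin.forall_fin_two] at this ⊢
    omega

theorem sum_toMat_le_two {φ : MulAut F2} (hφ : φ ∈ innIsom) :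
    toMat φ 0 0 + toMat φ 0 1 + (toMat φ 1 0 + toMat φ 1 1) ≤ 2 := by
  obtain ⟨u, δ, hδ, rfl⟩ := mem_innIsom_iff.1 hφ
  have ha := exponent_add_exponent_le_one ((norm_map hδ _).trans norm_genA)
  have hb := exponent_add_exponent_le_one ((norm_map hδ _).trans norm_genB)
  rw [map_mul, toMat_conj, one_mul, toMat_apply]
  simp only [Matrix.of_apply, Matrix.cons_val', Matrix.cons_val_zero, Matrix.cons_val_one]
  linarith

theorem exists_conj_of_toMat_eq_one {φ : MulAut F2} (h : toMat φ = 1) :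
    ∃ u, φ = MulAut.conj u := by
  have hφ : φ ∈ innIsom ⊔ Subgroup.closure transvections := by
    refine sup_le_sup_left ?_ innIsom (elementary_eq_top ▸ Subgroup.mem_top φ : φ ∈ elementary)
    exact Subgroup.zpowers_le.2 (Subgroup.subset_closure (Or.inl rfl))
  obtain ⟨_, ⟨d, hd, n, hn, rfl⟩, d', hd', e : d * n * d' = φ⟩ :=
    mem_double_coset_of_mem_sup_closure transvections_mul_innIsom_subset inv_transvections_subset
      (fun _ hσ _ hτ => inv_mul_transvection_mem hσ hτ) hφ
  have hn1 : n = 1 := by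
    have hmat : toMat (d⁻¹ * d'⁻¹) = toMat n := by
      rw [show n = d⁻¹ * φ * d'⁻¹ by rw [← e]; group]
      simp only [map_mul, h, mul_one]
    have hsum := sum_toMat_le_two (mul_mem (inv_mem hd) (inv_mem hd'))
    rw [hmat] at hsum
    exact (toMat_of_mem_closure_transvections hn).2.2.resolve_right (by omega)
  rw [hn1, mul_one] at e
  obtain ⟨u, δ, hδ, rfl⟩ := mem_innIsom_iff.1 (e ▸ mul_mem hd hd' : φ ∈ innIsom)
  rw [map_mul, toMat_conj, one_mul] at h
  exact ⟨u, by rw [eq_one_of_mem_isometries_of_toMat_eq_one hδ h, mul_one]⟩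

end Kernel

section FiniteOrderMatrices

variable {R : Type*} [CommRing R] {M : Matrix (Fin 2) (Fin 2) R}

theorem mul_self_fin_two (M : Matrix (Fin 2) (Fin 2) R) :
    M * M = M.trace • M - M.det • (1 : Matrix (Fin 2) (Fin 2) R) := by
  rw [Matrix.eta_fin_two M, Matrix.one_fin_two]
  ext i j
  fin_cases i <;> fin_cases j <;> simp <;> ring

variable [LinearOrder R] [IsStrictOrderedRing R]

/-- The coefficients satisfy `u_{k+1} = t u_k - u_{k-1}`, so they grow when `2 ≤ |t|`. -/
theorem exists_pow_succ_eq (hdet : M.det = 1) (htr : 2 ≤ |M.trace|) (k : ℕ) :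
    ∃ u v : R, |v| < |u| ∧ M ^ (k + 1) = u • M + v • (1 : Matrix (Fin 2) (Fin 2) R) := by
  induction k with
  | zero => exact ⟨1, 0, by simp, by simp⟩
  | succ k ih =>
    obtain ⟨u, v, huv, e⟩ := ih
    refine ⟨M.trace * u + v, -u, ?_, ?_⟩
    · have htri : |M.trace * u| ≤ |M.trace * u + v| + |v| := by
        simpa using abs_sub (M.trace * u + v) v
      have hgrow : 2 * |u| ≤ |M.trace * u| := by
        rw [abs_mul]
        exact mul_le_mul_of_nonneg_right htr (abs_nonneg u)
      rw [abs_neg]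
      linarith
    · rw [pow_succ, e, add_mul, smul_mul_assoc, mul_self_fin_two, hdet, smul_mul_assoc, one_mul]
      module

theorem eq_one_or_eq_neg_one_or_abs_trace_lt_two (hdet : M.det = 1) (hM : IsOfFinOrder M) :
    M = 1 ∨ M = -1 ∨ |M.trace| < 2 := by
  by_contra! hne
  obtain ⟨hne_one, hne_neg_one, htr⟩ := hne
  obtain ⟨n, hn, h⟩ := isOfFinOrder_iff_pow_eq_one.1 hM
  obtain ⟨k, rfl⟩ := Nat.exists_eq_succ_of_ne_zero hn.ne'
  obtain ⟨u, v, huv, e⟩ := exists_pow_succ_eq hdet htr k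
  have hu : u ≠ 0 := abs_pos.1 ((abs_nonneg v).trans_lt huv)
  rw [← Nat.succ_eq_add_one, h, Matrix.eta_fin_two M, Matrix.one_fin_two] at e
  have e01 : M 0 1 = 0 := by simpa [hu] using (congrFun (congrFun e 0) 1).symm
  have e10 : M 1 0 = 0 := by simpa [hu] using (congrFun (congrFun e 1) 0).symm
  have e00 : 1 = u * M 0 0 + v := by simpa using congrFun (congrFun e 0) 0
  have e11 : 1 = u * M 1 1 + v := by simpa using congrFun (congrFun e 1) 1
  have hscalar : M 0 0 = M 1 1 := mul_left_cancel₀ hu (by linarith)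
  rw [Matrix.det_fin_two, e01, hscalar, zero_mul, sub_zero] at hdet
  rw [Matrix.eta_fin_two M, e01, e10, hscalar] at hne_one hne_neg_one
  rcases mul_self_eq_one_iff.1 hdet with h1 | h1
  · exact hne_one (by rw [h1, Matrix.one_fin_two])
  · exact hne_neg_one (by rw [h1, Matrix.one_fin_two]; simp)

theorem trace_eq_zero_of_det_eq_neg_one (hdet : M.det = -1) (hM : IsOfFinOrder M) :
    M.trace = 0 := by
  have hdet' : (M * M).det = 1 := by rw [Matrix.det_mul, hdet]; norm_num
  have htr : (M * M).trace = M.trace ^ 2 + 2 := by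
    rw [mul_self_fin_two, hdet]
    simp [Matrix.trace_fin_two]
    ring
  have hM' : IsOfFinOrder (M * M) := by simpa only [pow_two] using hM.pow (n := 2)
  rcases eq_one_or_eq_neg_one_or_abs_trace_lt_two hdet' hM' with h | h | h
  · rw [h] at htr
    simpa using htr
  · rw [h, Matrix.trace_neg, Matrix.trace_one, Fintype.card_fin] at htr
    push_cast at htr
    nlinarith [sq_nonneg M.trace]
  · rw [htr, abs_lt] at h
    nlinarith [sq_nonneg M.trace]

end FiniteOrderMatrices

section GaussReduction

variable {φ : MulAut F2} {M N : Matrix (Fin 2) (Fin 2) ℤ} {a b c d : ℤ}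

/-- The matrix `M` is obtained from that of `φ` by a change of basis of `F₂`. -/
def HasMatrix (φ : MulAut F2) (M : Matrix (Fin 2) (Fin 2) ℤ) : Prop :=
  ∃ ψ, IsConj φ ψ ∧ toMat ψ = M

namespace HasMatrix

theorem of_mul_eq (h : HasMatrix φ M) (σ : MulAut F2)
    (e : toMat σ * M = N * toMat σ) : HasMatrix φ N := by
  obtain ⟨ψ, hψ, rfl⟩ := h
  refine ⟨σ * ψ * σ⁻¹, hψ.trans (isConj_iff.2 ⟨σ, rfl⟩), ?_⟩
  rw [map_mul, map_mul, e, mul_assoc, ← map_mul, mul_inv_cancel, map_one, mul_one]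

theorem swap (h : HasMatrix φ !![a, b; c, d]) : HasMatrix φ !![d, c; b, a] :=
  h.of_mul_eq autP (by simp)

theorem sign (h : HasMatrix φ !![a, b; c, d]) : HasMatrix φ !![a, -b; -c, d] :=
  h.of_mul_eq autE (by simp)

theorem toMat_autT_zpow (k : ℤ) : toMat (autT ^ k) = !![1, k; 0, 1] := by
  have hinv : autT⁻¹ genB = genB * genA⁻¹ := by
    rw [MulAut.inv_apply, MulEquiv.symm_apply_eq]
    simp
  have hinv' : autT⁻¹ genA = genA := by
    rw [MulAut.inv_apply, MulEquiv.symm_apply_eq, autT_genA]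
  induction k using Int.induction_on with
  | zero => rw [zpow_zero, map_one, Matrix.one_fin_two]
  | succ k ih => rw [zpow_add_one, map_mul, ih]; simp [add_comm]
  | pred k ih =>
    rw [zpow_sub_one, map_mul, ih, toMat_apply, hinv, hinv']
    simp [sub_eq_add_neg, add_comm]

theorem shear (h : HasMatrix φ !![a, b; c, d]) (k : ℤ) :
    HasMatrix φ !![a + k * c, b + k * (d - a) - k ^ 2 * c; c, d - k * c] := by
  refine h.of_mul_eq (autT ^ k) ?_
  rw [toMat_autT_zpow, Matrix.mul_fin_two, Matrix.mul_fin_two]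
  ext i j
  fin_cases i <;> fin_cases j <;> simp <;> ring

theorem isOfFinOrder (h : HasMatrix φ M) (hφ : IsOfFinOrder φ) : IsOfFinOrder M := by
  obtain ⟨ψ, hψ, rfl⟩ := h
  exact toMat.isOfFinOrder (hψ.isOfFinOrder hφ)

theorem exists_isConj {φ₀ : MulAut F2} (h : HasMatrix φ (toMat φ₀)) :
    ∃ u, IsConj φ (MulAut.conj u * φ₀) := by
  obtain ⟨ψ, hψ, e⟩ := h
  obtain ⟨u, hu⟩ := exists_conj_of_toMat_eq_one (φ := ψ * φ₀⁻¹) (by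
    rw [map_mul, e, ← map_mul, mul_inv_cancel, map_one])
  exact ⟨u, by rwa [← hu, inv_mul_cancel_right]⟩

end HasMatrix

theorem exists_abs_add_le (x : ℤ) {c : ℤ} (hc : c ≠ 0) : ∃ k : ℤ, |x + 2 * k * c| ≤ |c| := by
  refine ⟨-(c.sign * x.bdiv (2 * c.natAbs)), ?_⟩
  have e : x + 2 * -(c.sign * x.bdiv (2 * c.natAbs)) * c = x.bmod (2 * c.natAbs) := by
    have hsign : c.sign * c = c.natAbs := Int.sign_mul_self_eq_natAbs c
    rw [Int.bmod_eq_self_sub_mul_bdiv]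
    push_cast at hsign ⊢
    linear_combination (-2 * x.bdiv (2 * c.natAbs)) * hsign
  have hle := Int.le_bmod (x := x) (m := 2 * c.natAbs) (by omega)
  have hlt := Int.bmod_lt (x := x) (m := 2 * c.natAbs) (by omega)
  rw [e, Int.abs_eq_natAbs c, abs_le]
  omega

/-- Gauss's algorithm: shear to make `|a - d|` small, and swap as long as this decreases `|c|`. -/
theorem HasMatrix.exists_reduced (h : HasMatrix φ !![a, b; c, d]) :
    ∃ a b c d, HasMatrix φ !![a, b; c, d] ∧ (c ≠ 0 → |a - d| ≤ |c| ∧ |c| ≤ |b|) := by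
  induction hn : c.natAbs using Nat.strong_induction_on generalizing a b c d with
  | _ n ih =>
    subst hn
    by_cases hc : c = 0
    · exact ⟨a, b, c, d, h, absurd hc⟩
    obtain ⟨k, hk⟩ := exists_abs_add_le (a - d) hc
    rw [show a - d + 2 * k * c = a + k * c - (d - k * c) by ring] at hk
    rcases le_or_gt |c| |b + k * (d - a) - k ^ 2 * c| with hle | hlt
    · exact ⟨_, _, _, _, h.shear k, fun _ => ⟨hk, hle⟩⟩
    · exact ih _ (by zify; exact hlt) (h.shear k).swap rfl

end GaussReduction

section StandardMatrices

variable {φ : MulAut F2} {a b c d : ℤ}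

theorem hasMatrix_of_upper_triangular (h : HasMatrix φ !![a, b; 0, -a]) (ha : a * a = 1) :
    HasMatrix φ !![-1, 0; 0, 1] ∨ HasMatrix φ !![0, 1; 1, 0] := by
  have h' : HasMatrix φ !![a, b % 2; 0, -a] := by
    have e : b + a * (b / 2) * (-a - a) = b % 2 := by
      linear_combination (-2 * (b / 2)) * ha - Int.mul_ediv_add_emod b 2
    simpa [e] using h.shear (a * (b / 2))
  rcases mul_self_eq_one_iff.1 ha with rfl | rfl <;>
    rcases Int.emod_two_eq_zero_or_one b with hb | hb <;> rw [hb] at h'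
  · exact Or.inl h'.swap
  · exact Or.inr (by simpa using h'.swap.shear 1)
  · exact Or.inl h'
  · exact Or.inr (by simpa using h'.swap.shear (-1))

theorem hasMatrix_of_det_eq_neg_one (h : HasMatrix φ !![a, b; c, d])
    (hred : c ≠ 0 → |a - d| ≤ |c| ∧ |c| ≤ |b|) (hdet : a * d - b * c = -1) (htr : a + d = 0) :
    HasMatrix φ !![-1, 0; 0, 1] ∨ HasMatrix φ !![0, 1; 1, 0] := by
  obtain rfl : d = -a := by omega
  by_cases hc : c = 0
  · subst hc
    exact hasMatrix_of_upper_triangular h (by linarith)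
  · obtain ⟨hac, hcb⟩ := hred hc
    obtain rfl : a = 0 := by
      by_contra ha
      have h2a : |2 * a| ≤ |c| := by rwa [sub_neg_eq_add, ← two_mul] at hac
      have hbc : (2 * a) ^ 2 ≤ |b * c| := by
        rw [abs_mul, ← sq_abs, pow_two]
        exact mul_le_mul (h2a.trans hcb) h2a (abs_nonneg _) (abs_nonneg _)
      have ha2 : 0 < a ^ 2 := by positivity
      rw [show b * c = 1 - a ^ 2 by linarith, abs_of_nonpos (by linarith)] at hbc
      linarith
    rcases Int.eq_one_or_neg_one_of_mul_eq_one' (by linarith : b * c = 1) with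
      ⟨rfl, rfl⟩ | ⟨rfl, rfl⟩
    · right; simpa using h
    · right; simpa using h.sign

/-- The reduction conditions give `4 c² ≤ 4 |bc| ≤ 4 + c²`. -/
theorem abs_eq_one_of_det_eq_one (hac : |a - d| ≤ |c|) (hcb : |c| ≤ |b|) (hc : c ≠ 0)
    (hdet : a * d - b * c = 1) (htr : |a + d| < 2) : |c| = 1 := by
  have hsum : (a + d) ^ 2 ≤ 1 := (sq_le_one_iff_abs_le_one _).2 (by omega)
  have hbc : c ^ 2 ≤ |b * c| := by
    rw [abs_mul, ← sq_abs, pow_two]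
    exact mul_le_mul_of_nonneg_right hcb (abs_nonneg c)
  have e : 4 * (b * c) = (a + d) ^ 2 - (a - d) ^ 2 - 4 := by linarith
  rw [abs_of_nonpos (by linarith [sq_nonneg (a - d)])] at hbc
  have hsq : c ^ 2 < 2 ^ 2 := by linarith [sq_le_sq.2 hac, sq_nonneg (a + d)]
  have hlt : |c| < 2 := abs_lt_of_sq_lt_sq hsq (by norm_num)
  have hpos : 1 ≤ |c| := Int.one_le_abs hc
  omega

theorem hasMatrix_of_lower_left_eq_neg_one (h : HasMatrix φ !![a, b; -1, d])
    (hdiff : |a - d| ≤ 1) (hdet : a * d + b = 1) (htr : |a + d| < 2) :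
    HasMatrix φ !![0, 1; -1, 0] ∨ HasMatrix φ !![1, 1; -1, 0] ∨ HasMatrix φ !![0, 1; -1, -1] := by
  have had : a * d = 0 := by
    have hsum := (sq_le_one_iff_abs_le_one (a + d)).2 (by omega)
    have hdiff' := (sq_le_one_iff_abs_le_one (a - d)).2 hdiff
    have e : 4 * (a * d) = (a + d) ^ 2 - (a - d) ^ 2 := by ring
    have := sq_nonneg (a + d)
    have := sq_nonneg (a - d)
    omega
  obtain rfl : b = 1 := by omega
  rw [abs_lt] at htr
  rcases mul_eq_zero.1 had with rfl | rfl
  · obtain rfl | rfl | rfl : d = 0 ∨ d = 1 ∨ d = -1 := by omega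
    · exact Or.inl h
    · exact Or.inr (Or.inl (by simpa using h.swap.sign))
    · exact Or.inr (Or.inr h)
  · obtain rfl | rfl | rfl : a = 0 ∨ a = 1 ∨ a = -1 := by omega
    · exact Or.inl h
    · exact Or.inr (Or.inl h)
    · exact Or.inr (Or.inr (by simpa using h.swap.sign))

theorem hasMatrix_of_det_eq_one (h : HasMatrix φ !![a, b; c, d])
    (hred : c ≠ 0 → |a - d| ≤ |c| ∧ |c| ≤ |b|) (hdet : a * d - b * c = 1) (htr : |a + d| < 2) :
    HasMatrix φ !![0, 1; -1, 0] ∨ HasMatrix φ !![1, 1; -1, 0] ∨ HasMatrix φ !![0, 1; -1, -1] := by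
  have hc : c ≠ 0 := by
    rintro rfl
    rcases Int.eq_one_or_neg_one_of_mul_eq_one' (by linarith : a * d = 1) with
      ⟨rfl, rfl⟩ | ⟨rfl, rfl⟩ <;> norm_num at htr
  obtain ⟨hac, hcb⟩ := hred hc
  have hc1 := abs_eq_one_of_det_eq_one hac hcb hc hdet htr
  rw [hc1] at hac
  rcases eq_or_eq_neg_of_abs_eq hc1 with rfl | rfl
  · exact hasMatrix_of_lower_left_eq_neg_one h.sign hac (by linarith) htr
  · exact hasMatrix_of_lower_left_eq_neg_one h hac (by linarith) htr

/-- The inversion `a ↦ a⁻¹`, `b ↦ b⁻¹`. -/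
def autI : MulAut F2 := autX * autX

@[simp] theorem autI_genA : autI genA = genA⁻¹ := by simp [autI]

@[simp] theorem autI_genB : autI genB = genB⁻¹ := by simp [autI]

/-- The automorphism `a ↦ b⁻¹`, `b ↦ a b⁻¹` of order three. -/
def autW : MulAut F2 := autY * autY * (MulAut.conj genB)⁻¹

@[simp] theorem autW_genA : autW genA = genB⁻¹ := by
  simp [autW, mul_assoc]

@[simp] theorem autW_genB : autW genB = genA * genB⁻¹ := by
  simp [autW, mul_assoc]

@[simp] theorem toMat_autX : toMat autX = !![0, 1; -1, 0] := by
  rw [toMat_apply]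
  simp

@[simp] theorem toMat_autY : toMat autY = !![1, 1; -1, 0] := by
  rw [toMat_apply]
  simp

@[simp] theorem toMat_autI : toMat autI = -1 := by
  rw [toMat_apply, Matrix.one_fin_two]
  simp

@[simp] theorem toMat_autW : toMat autW = !![0, 1; -1, -1] := by
  rw [toMat_apply]
  simp

/-- Representatives of the conjugacy classes of elements of finite order in `Out(F₂) = GL₂(ℤ)`. -/
def outReps : Set (MulAut F2) := {1, autI, autE, autP, autX, autY, autW}

theorem exists_isConj_conj_mul_of_isOfFinOrder (hφ : IsOfFinOrder φ) :
    ∃ φ₀ ∈ outReps, ∃ u, IsConj φ (MulAut.conj u * φ₀) := by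
  suffices h : ∃ φ₀ ∈ outReps, HasMatrix φ (toMat φ₀) by
    obtain ⟨φ₀, hmem, h⟩ := h
    exact ⟨φ₀, hmem, h.exists_isConj⟩
  obtain ⟨a, b, c, d, h, hred⟩ := HasMatrix.exists_reduced ⟨φ, IsConj.refl φ, toMat_apply φ⟩
  have hfin := h.isOfFinOrder hφ
  simp only [outReps, Set.mem_insert_iff, Set.mem_singleton_iff, exists_eq_or_imp, exists_eq_left,
    map_one, toMat_autE, toMat_autP, toMat_autI, toMat_autX, toMat_autY, toMat_autW]
  have hdet : a * d - b * c = 1 ∨ a * d - b * c = -1 := by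
    rw [← Matrix.det_fin_two_of]
    exact Int.isUnit_iff.1 (Matrix.detMonoidHom.isOfFinOrder hfin).isUnit
  rcases hdet with hdet | hdet
  · rcases eq_one_or_eq_neg_one_or_abs_trace_lt_two (by rwa [Matrix.det_fin_two_of]) hfin with
      e | e | htr
    · exact Or.inl (e ▸ h)
    · exact Or.inr (Or.inl (e ▸ h))
    · rw [Matrix.trace_fin_two_of] at htr
      have := hasMatrix_of_det_eq_one h hred hdet htr
      tauto
  · have htr := trace_eq_zero_of_det_eq_neg_one (by rwa [Matrix.det_fin_two_of]) hfin
    rw [Matrix.trace_fin_two_of] at htr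
    have := hasMatrix_of_det_eq_neg_one h hred hdet htr
    tauto

end StandardMatrices

section Holomorph

variable {G : Type*} [Group G] {φ : MulAut G} {s t u v w z : G}

/-- Twisted conjugacy (Reidemeister equivalence): `w φ` and `s φ` are conjugate under `G` in the
holomorph. -/
def TwistedConj (φ : MulAut G) (w s : G) : Prop := ∃ u, w = u * s * (φ u)⁻¹

theorem TwistedConj.refl (φ : MulAut G) (w : G) : TwistedConj φ w w := ⟨1, by simp⟩

theorem TwistedConj.trans (h : TwistedConj φ w s) (h' : TwistedConj φ s t) :
    TwistedConj φ w t := by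
  obtain ⟨u, rfl⟩ := h
  obtain ⟨v, rfl⟩ := h'
  exact ⟨u * v, by simp [mul_assoc]⟩

theorem twistedConj_inv_of_map_eq_inv (h : φ s = s⁻¹) : TwistedConj φ s s⁻¹ := ⟨s, by simp [h]⟩

/-- The holomorph `G ⋊ Aut G`. -/
abbrev Holomorph (G : Type*) [Group G] : Type _ := G ⋊[MonoidHom.id (MulAut G)] MulAut G

/-- The element of the holomorph of `G` given by the pair of automorphisms `τ_u φ`, `τ_v φ`. When
`G` has trivial center, `w φ ↦ (τ_w φ, φ)` identifies the holomorph with the group of pairs of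
automorphisms having the same outer class. -/
def pairElt (φ : MulAut G) (u v : G) : Holomorph G := ⟨u * v⁻¹, MulAut.conj v * φ⟩

variable (G) in
/-- The homomorphism `w φ ↦ τ_w φ`. -/
def holToAut : Holomorph G →* MulAut G where
  toFun g := MulAut.conj g.left * g.right
  map_one' := by simp
  map_mul' g h := by
    rw [SemidirectProduct.mul_left, SemidirectProduct.mul_right, MonoidHom.id_apply, map_mul,
      mul_assoc, ← mul_assoc (MulAut.conj (g.right h.left)), ← mul_conj]
    simp only [mul_assoc]

theorem holToAut_pairElt (φ : MulAut G) (u v : G) :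
    holToAut G (pairElt φ u v) = MulAut.conj u * φ := by
  change MulAut.conj (u * v⁻¹) * (MulAut.conj v * φ) = _
  rw [← mul_assoc, ← map_mul, inv_mul_cancel_right]

theorem isOfFinOrder_conj_mul_of_pairElt (h : IsOfFinOrder (pairElt φ u v)) :
    IsOfFinOrder (MulAut.conj u * φ) ∧ IsOfFinOrder (MulAut.conj v * φ) := by
  rw [← holToAut_pairElt φ u v]
  exact ⟨(holToAut G).isOfFinOrder h, SemidirectProduct.rightHom.isOfFinOrder h⟩

theorem isConj_pairElt_of_twistedConj (hu : TwistedConj φ u s) (hv : TwistedConj φ v t) :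
    IsConj (pairElt φ u v) (pairElt φ s t) := by
  obtain ⟨c, rfl⟩ := hu
  obtain ⟨d, rfl⟩ := hv
  refine (isConj_iff.2 ⟨⟨c * d⁻¹, MulAut.conj d⟩, ?_⟩).symm
  rw [mul_inv_eq_iff_eq_mul]
  refine SemidirectProduct.ext (by simp [pairElt, mul_assoc]) ?_
  simp only [pairElt, SemidirectProduct.mul_right]
  rw [mul_assoc, mul_conj, ← mul_assoc, ← mul_assoc, ← map_mul, ← map_mul, inv_mul_cancel_right]

theorem isConj_pairElt_of_mul_eq {ψ : MulAut G} (h : ψ * φ = MulAut.conj z * φ * ψ) (u v : G) :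
    IsConj (pairElt φ u v) (pairElt φ (ψ u * z) (ψ v * z)) := by
  refine isConj_iff.2 ⟨SemidirectProduct.inr ψ, ?_⟩
  rw [mul_inv_eq_iff_eq_mul]
  refine SemidirectProduct.ext (by simp [pairElt, mul_assoc]) ?_
  simp only [pairElt, SemidirectProduct.mul_right, SemidirectProduct.right_inr]
  rw [← mul_assoc, mul_conj, mul_assoc, h, map_mul]
  simp only [mul_assoc]

theorem exists_isConj_pairElt {g : Holomorph G} (h : IsConj g.right (MulAut.conj v * φ)) :
    ∃ u, IsConj g (pairElt φ u v) := by
  obtain ⟨ψ, hψ⟩ := isConj_iff.1 h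
  refine ⟨ψ g.left * v, isConj_iff.2 ⟨SemidirectProduct.inr ψ, ?_⟩⟩
  rw [mul_inv_eq_iff_eq_mul] at *
  refine SemidirectProduct.ext (by simp [pairElt]) ?_
  simpa only [pairElt, SemidirectProduct.mul_right, SemidirectProduct.right_inr] using hψ

theorem twistedConj_one_of_isConj (h : IsConj (pairElt φ 1 1) (pairElt φ s 1)) :
    TwistedConj φ s 1 := by
  obtain ⟨c, hc⟩ := isConj_iff.1 h
  rw [mul_inv_eq_iff_eq_mul] at hc
  have hleft := congrArg SemidirectProduct.left hc
  refine ⟨c.left, ?_⟩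
  rw [mul_one, eq_mul_inv_iff_mul_eq]
  simpa [pairElt] using hleft.symm

end Holomorph

section TwistedConjugacyClasses

theorem exists_twistedConj_of_mem_isometries {α : Type*} [DecidableEq α] [Nontrivial α]
    {φ : MulAut (FreeGroup α)} {w : FreeGroup α} (hφ : φ ∈ isometries α) (hfin : IsOfFinOrder φ)
    (h : IsOfFinOrder (MulAut.conj w * φ)) :
    ∃ m, m.norm ≤ 1 ∧ φ m = m⁻¹ ∧ TwistedConj φ w m := by
  obtain ⟨n, hn, hw⟩ := exists_twistedPow_eq_one conj_injective hfin h
  obtain ⟨r, m, -, hm, hφm, e⟩ :=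
    exists_eq_mul_mul_inv_map hφ (norm_le_two_mul_gromovProduct hφ hn hw)
  exact ⟨m, hm, hφm, r, e⟩

theorem eq_one_or_gen_or_inv_gen {m : F2} (hm : m.norm ≤ 1) :
    m = 1 ∨ m = genA ∨ m = genA⁻¹ ∨ m = genB ∨ m = genB⁻¹ := by
  rcases Nat.le_one_iff_eq_zero_or_eq_one.1 hm with h | h
  · exact Or.inl (FreeGroup.norm_eq_zero.1 h)
  · exact Or.inr (eq_gen_or_inv_gen h)

variable {w : F2}

theorem autI_mul_self : autI * autI = 1 := aut_ext (by simp) (by simp)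

theorem autI_mem_isometries : autI ∈ isometries (Fin 2) :=
  mem_isometries_of_mul_self autI_mul_self (by simp) (by simp)

theorem autX_mem_isometries : autX ∈ isometries (Fin 2) := by
  rw [show autX = autP * autE from aut_ext (by simp) (by simp)]
  exact mul_mem autP_mem_isometries autE_mem_isometries

theorem isOfFinOrder_of_mul_self {M : Type*} [Monoid M] {g : M} (h : g * g = 1) :
    IsOfFinOrder g :=
  isOfFinOrder_iff_pow_eq_one.2 ⟨2, two_pos, (sq g).trans h⟩

theorem autX_pow_four : autX ^ 4 = 1 := by
  rw [pow_mul autX 2 2, sq autX, sq, ← autI, autI_mul_self]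

theorem twistedConj_autP (h : IsOfFinOrder (MulAut.conj w * autP)) : TwistedConj autP w 1 := by
  obtain ⟨m, hm, hPm, hw⟩ := exists_twistedConj_of_mem_isometries autP_mem_isometries
    (isOfFinOrder_of_mul_self autP_mul_self) h
  rcases eq_one_or_gen_or_inv_gen hm with rfl | rfl | rfl | rfl | rfl
  · exact hw
  all_goals exact absurd hPm (by decide)

theorem twistedConj_autX (h : IsOfFinOrder (MulAut.conj w * autX)) : TwistedConj autX w 1 := by
  obtain ⟨m, hm, hXm, hw⟩ := exists_twistedConj_of_mem_isometries autX_mem_isometries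
    (isOfFinOrder_iff_pow_eq_one.2 ⟨4, four_pos, autX_pow_four⟩) h
  rcases eq_one_or_gen_or_inv_gen hm with rfl | rfl | rfl | rfl | rfl
  · exact hw
  all_goals exact absurd hXm (by decide)

theorem twistedConj_autE (h : IsOfFinOrder (MulAut.conj w * autE)) :
    TwistedConj autE w 1 ∨ TwistedConj autE w genA⁻¹ := by
  obtain ⟨m, hm, hEm, hw⟩ := exists_twistedConj_of_mem_isometries autE_mem_isometries
    (isOfFinOrder_of_mul_self autE_mul_self) h
  rcases eq_one_or_gen_or_inv_gen hm with rfl | rfl | rfl | rfl | rfl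
  · exact Or.inl hw
  · exact Or.inr (hw.trans (twistedConj_inv_of_map_eq_inv autE_genA))
  · exact Or.inr hw
  all_goals exact absurd hEm (by decide)

theorem twistedConj_autI (h : IsOfFinOrder (MulAut.conj w * autI)) :
    TwistedConj autI w 1 ∨ TwistedConj autI w genA⁻¹ ∨ TwistedConj autI w genB⁻¹ := by
  obtain ⟨m, hm, -, hw⟩ := exists_twistedConj_of_mem_isometries autI_mem_isometries
    (isOfFinOrder_of_mul_self autI_mul_self) h
  rcases eq_one_or_gen_or_inv_gen hm with rfl | rfl | rfl | rfl | rfl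
  · exact Or.inl hw
  · exact Or.inr (Or.inl (hw.trans (twistedConj_inv_of_map_eq_inv autI_genA)))
  · exact Or.inr (Or.inl hw)
  · exact Or.inr (Or.inr (hw.trans (twistedConj_inv_of_map_eq_inv autI_genB)))
  · exact Or.inr (Or.inr hw)

theorem autY_pow_three : autY ^ 3 = MulAut.conj (genA * genB⁻¹) * autI := by
  rw [pow_succ, pow_two]
  exact aut_ext (by simp [mul_assoc]) (by simp [mul_assoc])

/-- `(τ_w y)³ = τ_u τ_a τ_b⁻¹ x²` where both exponent sums of `u` are even, whereas `τ_v x²` has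
infinite order when both exponent sums of `v` are odd. -/
theorem not_isOfFinOrder_conj_mul_autY (w : F2) : ¬ IsOfFinOrder (MulAut.conj w * autY) := by
  intro h
  have hcube := h.pow (n := 3)
  rw [conj_mul_pow, autY_pow_three, ← mul_assoc, ← map_mul] at hcube
  rcases twistedConj_autI hcube with ⟨u, hu⟩ | ⟨u, hu⟩ | ⟨u, hu⟩ <;>
  · have h0 := congrArg (exponent 0) hu
    have h1 := congrArg (exponent 1) hu
    simp [twistedPow, exponent_map _ u, exponent_map _ w, exponent_map _ (autY w)] at h0 h1
    omega

end TwistedConjugacyClasses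

section Theta

theorem autW_pow_three : autW ^ 3 = 1 := by
  rw [pow_succ, pow_two]
  exact aut_ext (by simp [mul_assoc]) (by simp [mul_assoc])

/-- The free group on the three edges of the theta graph, the graph with two vertices joined by
three edges, all of them oriented from the first vertex to the second. -/
abbrev F3 : Type := FreeGroup (Fin 3)

/-- The cyclic rotation of the three edges. -/
def rotation : MulAut F3 := FreeGroup.freeGroupCongr (Equiv.addRight 1)

@[simp] theorem rotation_of (i : Fin 3) : rotation (of i) = of (i + 1) := by simp [rotation]

/-- The fundamental group of the theta graph inside the free group on its edges, with `a` and `b`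
running along the edges `0` and `2` and back along the edge `1`. -/
def theta : F2 →* F3 := FreeGroup.lift ![of 0 * (of 1)⁻¹, of 2 * (of 1)⁻¹]

@[simp] theorem theta_genA : theta genA = of 0 * (of 1)⁻¹ := by simp [theta, genA]

@[simp] theorem theta_genB : theta genB = of 2 * (of 1)⁻¹ := by simp [theta, genB]

theorem theta_injective : Function.Injective theta := by
  let collapse : F3 →* F2 := FreeGroup.lift ![genA, 1, genB]
  have h : collapse.comp theta = MonoidHom.id F2 :=
    hom_ext (by simp [collapse]) (by simp [collapse])
  exact Function.LeftInverse.injective (g := collapse) fun w => DFunLike.congr_fun h w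

theorem theta_autW (w : F2) : theta (autW w) = rotation (theta w) := by
  have h : theta.comp autW.toMonoidHom = rotation.toMonoidHom.comp theta :=
    hom_ext (by simp) (by simp)
  exact DFunLike.congr_fun h w

theorem rotation_pow_three : rotation ^ 3 = 1 := by
  apply MulEquiv.toMonoidHom_injective
  ext i
  fin_cases i <;> simp [pow_succ]

theorem rotation_mem_isometries : rotation ∈ isometries (Fin 3) := by
  have hinv : rotation⁻¹ = rotation * rotation :=
    inv_eq_of_mul_eq_one_left (by rw [← pow_three', rotation_pow_three])
  exact mem_isometries_of_norm_le (by simp) (by simp [hinv])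

theorem eq_one_of_rotation_eq_inv {m : F3} (h : rotation m = m⁻¹) : m = 1 := by
  have h3 : (rotation ^ 3) m = m⁻¹ := by simp [pow_succ, h]
  rwa [rotation_pow_three, MulAut.one_apply, eq_inv_iff_mul_eq_one, ← sq, sq_eq_one] at h3

theorem mem_range_theta_of_isPrefix_gen {l r : F3} (hl : l.norm ≤ 1)
    (hmem : l * (of 1)⁻¹ ∈ theta.range) (hr : IsPrefix r (l * (of 1)⁻¹)) :
    r ∈ theta.range ∨ r * (of 1)⁻¹ ∈ theta.range := by
  rcases hr.mul_cases with hr | ⟨s, hs, rfl⟩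
  · rcases hr.eq_one_or_eq hl with rfl | rfl
    · exact Or.inl (one_mem _)
    · exact Or.inr hmem
  · rcases hs.eq_one_or_eq (by simp) with rfl | rfl
    · exact Or.inr (by rwa [mul_one])
    · exact Or.inl hmem

/-- A path in the theta graph that starts at the first vertex ends there, or does so after one more
edge. -/
theorem mem_range_theta_of_isPrefix {w : F2} {r : F3} (hr : IsPrefix r (theta w)) :
    r ∈ theta.range ∨ r * (of 1)⁻¹ ∈ theta.range := by
  induction w using FreeGroup.induction_on generalizing r with
  | C1 => exact Or.inl (((hr.eq_one_or_eq (by simp)).elim id fun e => by simpa using e) ▸ one_mem _)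
  | of i =>
    fin_cases i
    · exact mem_range_theta_of_isPrefix_gen (by simp) ⟨genA, theta_genA⟩ (theta_genA ▸ hr)
    · exact mem_range_theta_of_isPrefix_gen (by simp) ⟨genB, theta_genB⟩ (theta_genB ▸ hr)
  | inv_of i ih =>
    have hmem : theta (of i) ∈ theta.range := ⟨of i, rfl⟩
    rw [map_inv] at hr
    have := ih (by simpa using hr.inv_mul_inv)
    rwa [mul_assoc, Subgroup.mul_mem_cancel_left _ hmem,
      Subgroup.mul_mem_cancel_left _ hmem] at this
  | mul u v ihu ihv =>
    rw [map_mul] at hr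
    rcases hr.mul_cases with hr | ⟨s, hs, rfl⟩
    · exact ihu hr
    · have hmem : theta u ∈ theta.range := ⟨u, rfl⟩
      rw [mul_assoc, Subgroup.mul_mem_cancel_left _ hmem, Subgroup.mul_mem_cancel_left _ hmem]
      exact ihv hs

theorem twistedConj_autW {w : F2} (h : IsOfFinOrder (MulAut.conj w * autW)) :
    TwistedConj autW w 1 ∨ TwistedConj autW w genB⁻¹ := by
  obtain ⟨n, hn, hw⟩ := exists_twistedPow_eq_one conj_injective
    (isOfFinOrder_iff_pow_eq_one.2 ⟨3, three_pos, autW_pow_three⟩) h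
  have hθ : twistedPow rotation (theta w) n = 1 := by
    rw [← map_twistedPow theta_autW, hw, map_one]
  obtain ⟨r, m, hr, -, hm, e⟩ := exists_eq_mul_mul_inv_map rotation_mem_isometries
    (norm_le_two_mul_gromovProduct rotation_mem_isometries hn hθ)
  rw [eq_one_of_rotation_eq_inv hm, mul_one] at e
  rcases mem_range_theta_of_isPrefix hr with ⟨v, hv⟩ | ⟨v, hv⟩
  · refine Or.inl ⟨v, theta_injective ?_⟩
    rw [e, mul_one, map_mul, map_inv, theta_autW, hv]
  · refine Or.inr ⟨v, theta_injective ?_⟩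
    rw [e, ← inv_mul_cancel_right r (of 1), ← hv]
    simp [theta_autW, mul_assoc]

end Theta

section Representatives

/-- The outer class, among the five of `kindAut`, of each representative. -/
def repKind : Fin 10 → Fin 5 := ![0, 1, 1, 1, 1, 2, 2, 3, 3, 4]

/-- Representatives of the five nontrivial outer classes that occur in the holomorph. -/
def kindAut : Fin 5 → MulAut F2 := ![autP, autE, autI, autW, autX]

/-- The words `u`, `v` for which a representative with outer class `φ` is the pair `τ_u φ`,
`τ_v φ`. -/
def repTwist : Fin 10 → F2 × F2 :=
  ![(1, 1), (1, 1), (genA⁻¹, 1), (genA⁻¹, genA⁻¹), (genA⁻¹ * genA⁻¹, genA⁻¹), (1, 1), (genB⁻¹, 1),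
    (1, 1), (genB⁻¹, 1), (1, 1)]

theorem inr_eq_pairElt (φ : MulAut F2) : (SemidirectProduct.inr φ : Hol) = pairElt φ 1 1 :=
  SemidirectProduct.ext (by simp [pairElt]) (by simp [pairElt])

theorem inr_mul_inl_eq_pairElt (φ : MulAut F2) (u : F2) :
    (SemidirectProduct.inr φ * SemidirectProduct.inl u : Hol) = pairElt φ (φ u) 1 :=
  SemidirectProduct.ext (by simp [pairElt]) (by simp [pairElt])

theorem rep_eq (i : Fin 10) :
    rep i = pairElt (kindAut (repKind i)) (repTwist i).1 (repTwist i).2 := by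
  have hE : p * x = SemidirectProduct.inr autE := by rw [p, x, autE, map_mul]
  have hI : x ^ 2 = SemidirectProduct.inr autI := by rw [x, autI, ← sq, map_pow]
  have hW : y ^ 2 * τb⁻¹ = SemidirectProduct.inr autW := by
    rw [y, τb, autW, map_mul, ← sq, map_pow, map_inv]
  have hEa : autE * MulAut.conj genA = MulAut.conj genA⁻¹ * autE := by
    rw [mul_conj, autE_genA]
  fin_cases i
  · exact inr_eq_pairElt autP
  · exact hE.trans (inr_eq_pairElt autE)
  · change p * x * a = pairElt autE genA⁻¹ 1
    rw [hE, a, inr_mul_inl_eq_pairElt, autE_genA]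
  · change p * x * τa = pairElt autE genA⁻¹ genA⁻¹
    rw [hE, τa, ← map_mul, hEa]
    exact SemidirectProduct.ext (by simp [pairElt]) (by simp [pairElt])
  · change p * x * τa * a = pairElt autE (genA⁻¹ * genA⁻¹) genA⁻¹
    rw [hE, τa, ← map_mul, hEa]
    exact SemidirectProduct.ext (by simp [pairElt, a]) (by simp [pairElt, a])
  · exact hI.trans (inr_eq_pairElt autI)
  · change x ^ 2 * b = pairElt autI genB⁻¹ 1
    rw [hI, b, inr_mul_inl_eq_pairElt, autI_genB]
  · exact hW.trans (inr_eq_pairElt autW)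
  · change y ^ 2 * τb⁻¹ * a = pairElt autW genB⁻¹ 1
    rw [hW, a, inr_mul_inl_eq_pairElt, autW_genA]
  · exact inr_eq_pairElt autX

theorem toMat_right_pairElt (φ : MulAut F2) (u v : F2) :
    toMat (pairElt φ u v).right = toMat φ := by
  simp only [pairElt, map_mul, toMat_conj, one_mul]

/-- The matrices of the five automorphisms `kindAut`. -/
def kindMat : Fin 5 → Matrix (Fin 2) (Fin 2) ℤ :=
  ![!![0, 1; 1, 0], !![-1, 0; 0, 1], -1, !![0, 1; -1, -1], !![0, 1; -1, 0]]

theorem toMat_kindAut (k : Fin 5) : toMat (kindAut k) = kindMat k := by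
  fin_cases k
  · exact toMat_autP
  · exact toMat_autE
  · exact toMat_autI
  · exact toMat_autW
  · exact toMat_autX

theorem kindMat_ne_one (k : Fin 5) : kindMat k ≠ 1 := by
  revert k
  decide

theorem rep_ne_one (i : Fin 10) : rep i ≠ 1 := by
  intro h
  apply kindMat_ne_one (repKind i)
  rw [← toMat_kindAut, ← toMat_right_pairElt _ (repTwist i).1 (repTwist i).2, ← rep_eq, h,
    SemidirectProduct.one_right, map_one]

theorem pairElt_pow_eq_one {φ : MulAut F2} {u v : F2} {n : ℕ} (hφ : φ ^ n = 1)
    (hu : twistedPow φ u n = 1) (hv : twistedPow φ v n = 1) : (pairElt φ u v : Hol) ^ n = 1 := by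
  have hright : (pairElt φ u v ^ n).right = 1 := by
    change SemidirectProduct.rightHom (pairElt φ u v ^ n) = 1
    rw [map_pow]
    change (MulAut.conj v * φ) ^ n = 1
    rw [conj_mul_pow, hv, hφ, map_one, mul_one]
  have haut : holToAut F2 (pairElt φ u v ^ n) = 1 := by
    rw [map_pow, holToAut_pairElt, conj_mul_pow, hu, hφ, map_one, mul_one]
  refine SemidirectProduct.ext (conj_injective ?_) hright
  change MulAut.conj _ * _ = 1 at haut
  rwa [hright, mul_one, ← map_one MulAut.conj] at haut

theorem rep_pow_repOrder (i : Fin 10) : rep i ^ repOrder i = 1 := by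
  have hgen : ∀ i, (kindAut (repKind i) ^ repOrder i) genA = genA ∧
      (kindAut (repKind i) ^ repOrder i) genB = genB := by decide
  have htwist : ∀ i, twistedPow (kindAut (repKind i)) (repTwist i).1 (repOrder i) = 1 ∧
      twistedPow (kindAut (repKind i)) (repTwist i).2 (repOrder i) = 1 := by decide
  rw [rep_eq]
  exact pairElt_pow_eq_one (aut_ext (hgen i).1 (hgen i).2) (htwist i).1 (htwist i).2

theorem orderOf_rep (i : Fin 10) : orderOf (rep i) = repOrder i := by
  have hprime : i = 9 ∨ (repOrder i).Prime := by
    revert i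
    decide
  rcases hprime with rfl | hprime
  · exact orderOf_eq_prime_pow (p := 2) (n := 1) (rep_ne_one 5) (rep_pow_repOrder 9)
  · have : Fact (repOrder i).Prime := ⟨hprime⟩
    exact orderOf_eq_prime (rep_pow_repOrder i) (rep_ne_one i)

end Representatives

section Existence

variable {u v : F2}

theorem isConj_rep_of_twistedConj (i : Fin 10)
    (hu : TwistedConj (kindAut (repKind i)) u (repTwist i).1)
    (hv : TwistedConj (kindAut (repKind i)) v (repTwist i).2) :
    IsConj (pairElt (kindAut (repKind i)) u v) (rep i) := by
  rw [rep_eq]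
  exact isConj_pairElt_of_twistedConj hu hv

theorem not_isConj_pairElt_one {g : Hol} (hg : IsOfFinOrder g) (hg1 : g ≠ 1) :
    ¬ IsConj g (pairElt 1 u v) := by
  have hone {w : F2} (h : IsOfFinOrder (MulAut.conj w * 1)) : w = 1 := by
    rwa [mul_one, conj_injective.isOfFinOrder_iff, isOfFinOrder_iff_eq_one] at h
  intro h
  obtain ⟨hu, hv⟩ := isOfFinOrder_conj_mul_of_pairElt (h.isOfFinOrder hg)
  apply hg1
  rwa [hone hu, hone hv, ← inr_eq_pairElt, map_one, isConj_one_left] at h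

theorem exists_isConj_rep_autP (h : IsOfFinOrder (pairElt autP u v)) :
    ∃ i, IsConj (pairElt autP u v) (rep i) := by
  obtain ⟨hu, hv⟩ := isOfFinOrder_conj_mul_of_pairElt h
  exact ⟨0, isConj_rep_of_twistedConj 0 (twistedConj_autP hu) (twistedConj_autP hv)⟩

theorem exists_isConj_rep_autX (h : IsOfFinOrder (pairElt autX u v)) :
    ∃ i, IsConj (pairElt autX u v) (rep i) := by
  obtain ⟨hu, hv⟩ := isOfFinOrder_conj_mul_of_pairElt h
  exact ⟨9, isConj_rep_of_twistedConj 9 (twistedConj_autX hu) (twistedConj_autX hv)⟩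

theorem exists_isConj_rep_autE (h : IsOfFinOrder (pairElt autE u v)) :
    ∃ i, IsConj (pairElt autE u v) (rep i) := by
  obtain ⟨hu, hv⟩ := isOfFinOrder_conj_mul_of_pairElt h
  rcases twistedConj_autE hu with hu | hu <;> rcases twistedConj_autE hv with hv | hv
  · exact ⟨1, isConj_rep_of_twistedConj 1 hu hv⟩
  · exact ⟨4, isConj_rep_of_twistedConj 4 (hu.trans ⟨genA, by simp [repTwist]⟩) hv⟩
  · exact ⟨2, isConj_rep_of_twistedConj 2 hu hv⟩
  · exact ⟨3, isConj_rep_of_twistedConj 3 hu hv⟩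

theorem isConj_pairElt_autI_map_autP (u v : F2) :
    IsConj (pairElt autI u v) (pairElt autI (autP u) (autP v)) := by
  simpa using isConj_pairElt_of_mul_eq (φ := autI) (ψ := autP) (z := 1)
    (aut_ext (by simp) (by simp)) u v

theorem exists_isConj_pairElt_autI_one (u : F2) (hv : IsOfFinOrder (MulAut.conj v * autI)) :
    ∃ u', IsConj (pairElt autI u v) (pairElt autI u' 1) := by
  have hshear (u : F2) : ∃ u', IsConj (pairElt autI u genA⁻¹) (pairElt autI u' 1) := by
    have h := isConj_pairElt_of_mul_eq (φ := autI) (ψ := autT) (z := genA⁻¹)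
      (aut_ext (by simp) (by simp [mul_assoc])) (autT⁻¹ (u * genA)) 1
    rw [MulAut.apply_inv_self, mul_inv_cancel_right, map_one, one_mul] at h
    exact ⟨_, h.symm⟩
  rcases twistedConj_autI hv with hv | hv | hv
  · exact ⟨u, isConj_pairElt_of_twistedConj (.refl _ u) hv⟩
  · obtain ⟨u', hu'⟩ := hshear u
    exact ⟨u', (isConj_pairElt_of_twistedConj (.refl _ u) hv).trans hu'⟩
  · obtain ⟨u', hu'⟩ := hshear (autP u)
    have hswap := isConj_pairElt_autI_map_autP u genB⁻¹
    rw [map_inv, autP_genB] at hswap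
    exact ⟨u', ((isConj_pairElt_of_twistedConj (.refl _ u) hv).trans hswap).trans hu'⟩

theorem exists_isConj_rep_autI (h : IsOfFinOrder (pairElt autI u v)) :
    ∃ i, IsConj (pairElt autI u v) (rep i) := by
  obtain ⟨u', hu'⟩ := exists_isConj_pairElt_autI_one u (isOfFinOrder_conj_mul_of_pairElt h).2
  rcases twistedConj_autI (isOfFinOrder_conj_mul_of_pairElt (hu'.isOfFinOrder h)).1 with
    hu | hu | hu
  · exact ⟨5, hu'.trans (isConj_rep_of_twistedConj 5 hu (.refl _ 1))⟩
  · have hswap := isConj_pairElt_autI_map_autP genA⁻¹ 1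
    rw [map_inv, autP_genA, map_one] at hswap
    refine ⟨6, (hu'.trans (isConj_pairElt_of_twistedConj hu (.refl _ 1))).trans (hswap.trans ?_)⟩
    exact isConj_rep_of_twistedConj 6 (.refl _ _) (.refl _ 1)
  · exact ⟨6, hu'.trans (isConj_rep_of_twistedConj 6 hu (.refl _ 1))⟩

theorem exists_isConj_pairElt_autW_one (u : F2) (hv : IsOfFinOrder (MulAut.conj v * autW)) :
    ∃ u', IsConj (pairElt autW u v) (pairElt autW u' 1) := by
  rcases twistedConj_autW hv with hv | hv
  · exact ⟨u, isConj_pairElt_of_twistedConj (.refl _ u) hv⟩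
  · have hflip := isConj_pairElt_of_mul_eq (φ := autW) (ψ := autI) (z := genB⁻¹)
      (aut_ext (by simp) (by simp [mul_assoc])) u genB⁻¹
    rw [map_inv, autI_genB, inv_inv, mul_inv_cancel] at hflip
    exact ⟨_, (isConj_pairElt_of_twistedConj (.refl _ u) hv).trans hflip⟩

theorem exists_isConj_rep_autW (h : IsOfFinOrder (pairElt autW u v)) :
    ∃ i, IsConj (pairElt autW u v) (rep i) := by
  obtain ⟨u', hu'⟩ := exists_isConj_pairElt_autW_one u (isOfFinOrder_conj_mul_of_pairElt h).2
  rcases twistedConj_autW (isOfFinOrder_conj_mul_of_pairElt (hu'.isOfFinOrder h)).1 with hu | hu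
  · exact ⟨7, hu'.trans (isConj_rep_of_twistedConj 7 hu (.refl _ 1))⟩
  · exact ⟨8, hu'.trans (isConj_rep_of_twistedConj 8 hu (.refl _ 1))⟩

theorem exists_isConj_rep {g : Hol} (hg : IsOfFinOrder g) (hg1 : g ≠ 1) :
    ∃ i, IsConj g (rep i) := by
  obtain ⟨φ, hφ, v, hv⟩ :=
    exists_isConj_conj_mul_of_isOfFinOrder (SemidirectProduct.rightHom.isOfFinOrder hg)
  obtain ⟨u, hu⟩ := exists_isConj_pairElt hv
  have hfin := hu.isOfFinOrder hg
  suffices h : ∃ i, IsConj (pairElt φ u v) (rep i) from h.imp fun _ => hu.trans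
  rcases hφ with rfl | rfl | rfl | rfl | rfl | rfl | rfl
  · exact absurd hu (not_isConj_pairElt_one hg hg1)
  · exact exists_isConj_rep_autI hfin
  · exact exists_isConj_rep_autE hfin
  · exact exists_isConj_rep_autP hfin
  · exact exists_isConj_rep_autX hfin
  · exact absurd (isOfFinOrder_conj_mul_of_pairElt hfin).2 (not_isOfFinOrder_conj_mul_autY v)
  · exact exists_isConj_rep_autW hfin

end Existence

section Uniqueness

variable {s t : F2}

theorem not_twistedConj_autI : ¬ TwistedConj autI genB⁻¹ 1 := by
  rintro ⟨u, hu⟩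
  have h1 := congrArg (exponent 1) hu
  simp [exponent_map _ u] at h1
  omega

theorem not_twistedConj_autW : ¬ TwistedConj autW genB⁻¹ 1 := by
  rintro ⟨u, hu⟩
  have h0 := congrArg (exponent 0) hu
  have h1 := congrArg (exponent 1) hu
  simp [exponent_map _ u] at h0 h1
  omega

theorem toMat_eq_of_commute_toMat_autE {φ : MulAut F2}
    (h : Commute (toMat φ) (toMat autE)) :
    ∃ a d : ℤˣ, toMat φ = !![(a : ℤ), 0; 0, (d : ℤ)] := by
  have hdet : IsUnit (toMat φ).det := (Group.isUnit φ).map toMat |>.map Matrix.detMonoidHom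
  rw [Commute, SemiconjBy, toMat_autE, Matrix.eta_fin_two (toMat φ)] at h
  simp at h
  have h01 : toMat φ 0 1 = 0 := by omega
  have h10 : toMat φ 1 0 = 0 := by omega
  rw [Matrix.det_fin_two, h01, zero_mul, sub_zero, IsUnit.mul_iff] at hdet
  obtain ⟨⟨a, ha⟩, d, hd⟩ := hdet
  exact ⟨a, d, by rw [Matrix.eta_fin_two (toMat φ), h01, h10, ha, hd]⟩

theorem exists_commute_autE {φ : MulAut F2} (h : Commute (toMat φ) (toMat autE)) :
    ∃ d, toMat d = toMat φ ∧ Commute d autE ∧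
      ∀ u, exponent 0 (d u) ≡ exponent 0 u [ZMOD 2] := by
  obtain ⟨a, d, had⟩ := toMat_eq_of_commute_toMat_autE h
  rw [had]
  rcases Int.units_eq_one_or a with rfl | rfl <;> rcases Int.units_eq_one_or d with rfl | rfl
  · exact ⟨1, by simp [Matrix.one_fin_two], .one_left _, fun u => rfl⟩
  · exact ⟨autI * autE, by simp [toMat_apply], aut_ext (by simp) (by simp),
      fun u => by simp [exponent_map _ u, exponent_map _ (autE u)]⟩
  · exact ⟨autE, by simp, .refl _, fun u => by simp [exponent_map _ u, Int.ModEq]⟩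
  · exact ⟨autI, by simp [toMat_apply], aut_ext (by simp) (by simp),
      fun u => by simp [exponent_map _ u, Int.ModEq]⟩

/-- The conjugator is `τ_u d` for some `d` commuting with `autE`, so that `t = u d(s) autE(u)⁻¹`. -/
theorem exponent_modEq_of_isConj_conj_mul_autE
    (h : IsConj (MulAut.conj s * autE) (MulAut.conj t * autE)) :
    exponent 0 s ≡ exponent 0 t [ZMOD 2] := by
  obtain ⟨φ, hφ⟩ := isConj_iff.1 h
  rw [mul_inv_eq_iff_eq_mul] at hφ
  have hcomm : Commute (toMat φ) (toMat autE) := by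
    simpa only [map_mul, toMat_conj, one_mul, Commute, SemiconjBy] using congrArg toMat hφ
  obtain ⟨d, hd, hdE, hmod⟩ := exists_commute_autE hcomm
  obtain ⟨u, hu⟩ := exists_conj_of_toMat_eq_one (φ := φ * d⁻¹)
    (by rw [map_mul, ← hd, ← map_mul, mul_inv_cancel, map_one])
  obtain rfl : φ = MulAut.conj u * d := mul_inv_eq_iff_eq_mul.1 hu
  have hconj : MulAut.conj (u * d s) * (autE * d) = MulAut.conj (t * autE u) * (autE * d) := by
    calc MulAut.conj (u * d s) * (autE * d)
        = MulAut.conj u * (MulAut.conj (d s) * d) * autE := by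
          rw [← hdE.eq, map_mul]; simp only [mul_assoc]
      _ = MulAut.conj u * d * (MulAut.conj s * autE) := by
          rw [← mul_conj]; simp only [mul_assoc]
      _ = MulAut.conj t * (autE * MulAut.conj u) * d := by rw [hφ]; simp only [mul_assoc]
      _ = MulAut.conj (t * autE u) * (autE * d) := by
          rw [mul_conj, map_mul]; simp only [mul_assoc]
  have hexp := congrArg (exponent 0) (conj_injective (mul_right_cancel hconj))
  have hEu : exponent 0 (autE u) = -exponent 0 u := by simp [exponent_map _ u]
  have := hmod s
  rw [exponent_mul, exponent_mul, hEu] at hexp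
  rw [Int.ModEq] at *
  omega

/-- Reduction modulo `2` separates the classes of `autP` and `autE`, which have equal trace and
determinant. -/
theorem eq_of_isConj_kindMat {k l : Fin 5} (h : IsConj (kindMat k) (kindMat l)) : k = l := by
  let mod2 : Matrix (Fin 2) (Fin 2) ℤ →+* Matrix (Fin 2) (Fin 2) (ZMod 2) :=
    (Int.castRingHom (ZMod 2)).mapMatrix
  have htrace : (kindMat k).trace = (kindMat l).trace := by
    obtain ⟨c, hc⟩ := h
    rw [← Matrix.trace_units_conj c, hc.eq, mul_assoc, Units.mul_inv, mul_one]
  have hdet : (kindMat k).det = (kindMat l).det :=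
    isConj_iff_eq.1 (Matrix.detMonoidHom.map_isConj h)
  have hmod : mod2 (kindMat k) = 1 ↔ mod2 (kindMat l) = 1 := by
    have hconj := mod2.map_isConj h
    exact ⟨fun e => isConj_one_right.1 (e ▸ hconj), fun e => isConj_one_left.1 (e ▸ hconj)⟩
  rw [Matrix.trace_fin_two, Matrix.trace_fin_two] at htrace
  rw [Matrix.det_fin_two, Matrix.det_fin_two] at hdet
  clear h
  revert k l
  decide

theorem repKind_eq_of_isConj_rep {i j : Fin 10} (h : IsConj (rep i) (rep j)) :
    repKind i = repKind j := by
  apply eq_of_isConj_kindMat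
  rw [rep_eq, rep_eq] at h
  have hmat := toMat.map_isConj (SemidirectProduct.rightHom.map_isConj h)
  simpa only [SemidirectProduct.rightHom_eq_right, toMat_right_pairElt, toMat_kindAut] using hmat

theorem eq_of_isConj_rep_of_repKind_eq_one {i j : Fin 10} (hi : repKind i = 1)
    (hj : repKind j = 1) (h : IsConj (rep i) (rep j)) : i = j := by
  rw [rep_eq, rep_eq, hi, hj] at h
  have haut := (holToAut F2).map_isConj h
  rw [holToAut_pairElt, holToAut_pairElt] at haut
  have hfst := exponent_modEq_of_isConj_conj_mul_autE haut
  have hsnd := exponent_modEq_of_isConj_conj_mul_autE (SemidirectProduct.rightHom.map_isConj h)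
  clear h haut
  revert i j
  decide

theorem eq_of_isConj_rep {i j : Fin 10} (h : IsConj (rep i) (rep j)) : i = j := by
  wlog hij : i ≤ j generalizing i j
  · exact (this h.symm (le_of_not_ge hij)).symm
  have hcases : ∀ i j : Fin 10, repKind i = repKind j → i ≤ j →
      i = j ∨ (repKind i = 1 ∧ repKind j = 1) ∨ (i = 5 ∧ j = 6) ∨ (i = 7 ∧ j = 8) := by
    decide
  rcases hcases i j (repKind_eq_of_isConj_rep h) hij with
    hij | ⟨hi, hj⟩ | ⟨rfl, rfl⟩ | ⟨rfl, rfl⟩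
  · exact hij
  · exact eq_of_isConj_rep_of_repKind_eq_one hi hj h
  all_goals rw [rep_eq, rep_eq] at h
  · exact absurd (twistedConj_one_of_isConj h) not_twistedConj_autI
  · exact absurd (twistedConj_one_of_isConj h) not_twistedConj_autW

end Uniqueness

end HolF2

theorem mainTheorem4 :
    (∀ g : HolF2.Hol, IsOfFinOrder g → g ≠ 1 → ∃! i : Fin 10, IsConj g (HolF2.rep i)) ∧
      ∀ i : Fin 10, orderOf (HolF2.rep i) = HolF2.repOrder i := by
  refine ⟨fun g hg hg1 => ?_, HolF2.orderOf_rep⟩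
  obtain ⟨i, hi⟩ := HolF2.exists_isConj_rep hg hg1
  exact ⟨i, hi, fun j hj => HolF2.eq_of_isConj_rep (hj.symm.trans hi)⟩
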